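/- There are universal constants $A,B,\bar A,\bar B\in(0,\infty)$ with the following property. Let $N\ge 1$, let $X_1,\dots,X_N$ be independent random variables with values in a measurable space $\mathcal X$, let $\mathcal F$ be a non-empty family of real measurable functions on $\mathcal X$, and let $d$ be a (pseudo-)distance on $\mathcal F\cup\{0\}$ such that for all $f,g\in\mathcal F$, all $1\le i\le N$ and all $u>0$ $$\mathbb P(|(f-g)(X_i)|\ge u)\le 2\exp\Bigl(-\frac{u^2}{d(f,g)^2}\Bigr),\qquad \mathbb P(|f(X_i)|\ge u)\le 2\exp\Bigl(-\frac{u^2}{d(f,0)^2}\Bigr),$$ where a right-hand side with $d(f,g)=0$, respectively $d(f,0)=0$, is read as $0$. Put $$S_N(f)=\frac1N\sum_{i=1}^N\bigl(f^2(X_i)-\mathbb E f^2(X_i)\bigr),\qquad f\in\mathcal F,$$ and assume that the process $(S_N(f))_{f\in\mathcal F}$ is separable: there is a countable $\mathcal F_*\subset\mathcal F$ such that almost surely, for every $f\in\mathcal F$ and $\varepsilon>0$, there is $g\in\mathcal F_*$ with $d(f,g)<\varepsilon$ and $|S_N(f)-S_N(g)|<\varepsilon$. Assume that $\alpha=\sup_{f\in\mathcal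 F}d(f,0)<\infty$ and $\gamma_2(\mathcal F)<\infty$, where $$\gamma_2(\mathcal F)=\inf\ \sup_{f\in\mathcal F}\ \sum_{n\ge 0}2^n d(f,\mathcal F_n),$$ the infimum being taken over all increasing sequences $(\mathcal F_n)_{n\ge0}$ of finite subsets of $\mathcal F$ with $|\mathcal F_0|=1$, $|\mathcal F_n|\le 2^{2^{2n}}-1$ for $n\ge1$, and with $\bigcup_n\mathcal F_n$ dense in $(\mathcal F,d)$. Let $\varphi(x)=2^{\min\{\sqrt N\,x,\,x^2\}}-1$ for $x\ge0$, and let $\varphi^{-1}(y)=\max\{N^{-1/2}\log_2(1+y),\sqrt{\log_2(1+y)}\}$ be its inverse on $[0,\infty)$. Then: (i) there is a random variable $Z\ge0$ with $\mathbb E Z\le1$ such that, almost surely, $$\sup_{f\in\mathcal F}S_N(f)\le A\bigl(N^{-1}\gamma_2(\mathcal F)^2+N^{-1/2}\alpha\,\gamma_2(\mathcal F)\bigr)+B\,N^{-1/2}\alpha^2\varphi^{-1}(Z);$$ (ii) for all $u\ge0$, $$\mathbb P\Bigl(\sup_{f\in\mathcal F}S_N(f)>\bar A\bigl(N^{-1}\gamma_2(\mathcal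 F)^2+N^{-1/2}\alpha\,\gamma_2(\mathcal F)\bigr)+\bar B\,N^{-1/2}\alpha^2u\Bigr)\le\exp\bigl(-\min\{\sqrt N\,u,\,u^2\}\bigr).$$ -/

import Mathlib

open MeasureTheory ProbabilityTheory
open scoped ENNReal

universe u v

section Distance

variable {E : Type v}

/-- `d` is a (pseudo-)distance on the set `S`. -/
structure IsDistOn (d : E → E → ℝ) (S : Set E) : Prop where
  nonneg : ∀ f ∈ S, ∀ g ∈ S, 0 ≤ d f g
  self : ∀ f ∈ S, d f f = 0
  symm : ∀ f ∈ S, ∀ g ∈ S, d f g = d g f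
  triangle : ∀ f ∈ S, ∀ g ∈ S, ∀ h ∈ S, d f h ≤ d f g + d g h

/-- An admissible sequence of nets of `F`: an increasing sequence of finite subsets `T n` of `F`
with `|T 0| = 1`, `|T n| ≤ N_n = 2 ^ (2 ^ (2 n)) - 1` for `n ≥ 1`, and dense union. -/
structure IsAdmissible (d : E → E → ℝ) (F : Set E) (T : ℕ → Finset E) : Prop where
  subset : ∀ n, (T n : Set E) ⊆ F
  mono : ∀ n, T n ⊆ T (n + 1)
  card_zero : (T 0).card = 1
  card_le : ∀ n, 1 ≤ n → (T n).card ≤ 2 ^ (2 ^ (2 * n)) - 1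
  dense : ∀ f ∈ F, ∀ ε : ℝ, 0 < ε → ∃ n, ∃ g ∈ T n, d f g < ε

/-- The distance `d(f, T)` from the point `f` to the set `T`. -/
noncomputable def distTo (d : E → E → ℝ) (f : E) (T : Finset E) : ℝ≥0∞ :=
  ⨅ g ∈ T, ENNReal.ofReal (d f g)

/-- `γ₂(F) = inf sup_{f ∈ F} ∑_{n ≥ 0} 2 ^ n d(f, F_n)`, the infimum being over all admissible
sequences `(F_n)` of nets of `F`. -/
noncomputable def gammaTwo (d : E → E → ℝ) (F : Set E) : ℝ≥0∞ :=
  ⨅ (T : ℕ → Finset E) (_ : IsAdmissible d F T), ⨆ f ∈ F, ∑' n : ℕ, 2 ^ n * distTo d f (T n)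

/-- Separability of the process `(Y f)`, `f ∈ F`, with respect to `d`: there is a countable
`F₀ ⊆ F` such that almost surely every value `Y f` is a limit of values `Y g` with `g ∈ F₀`,
`d(f, g) → 0`. -/
def IsSeparableProcess {Ω : Type u} [MeasurableSpace Ω] (μ : Measure Ω) (d : E → E → ℝ)
    (F : Set E) (Y : E → Ω → ℝ) : Prop :=
  ∃ F₀ : Set E, F₀ ⊆ F ∧ F₀.Countable ∧
    ∀ᵐ ω ∂μ, ∀ f ∈ F, ∀ ε : ℝ, 0 < ε → ∃ g ∈ F₀, d f g < ε ∧ |Y f ω - Y g ω| < ε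

end Distance

/-- The bound `2 exp (- u² / D²)`, which for `u > 0` and `D = 0` is read as `0`. -/
noncomputable def subgaussianTail (u D : ℝ) : ℝ :=
  if D = 0 then 0 else 2 * Real.exp (-(u ^ 2 / D ^ 2))

/-- The centred empirical squares `S_N(f) = N⁻¹ ∑_i (f² - 𝔼 f²)(X_i)`. -/
noncomputable def empiricalSq {Ω : Type u} {𝒳 : Type v} [MeasurableSpace Ω] {N : ℕ}
    (μ : Measure Ω) (X : Fin N → Ω → 𝒳) (f : 𝒳 → ℝ) (ω : Ω) : ℝ :=
  (1 / (N : ℝ)) * ∑ i : Fin N, (f (X i ω) ^ 2 - ∫ ω', f (X i ω') ^ 2 ∂μ)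

/-- `sup_{f ∈ F} S_N(f)`, as an extended real number. -/
noncomputable def supEmpiricalSq {Ω : Type u} {𝒳 : Type v} [MeasurableSpace Ω] {N : ℕ}
    (μ : Measure Ω) (X : Fin N → Ω → 𝒳) (F : Set (𝒳 → ℝ)) (ω : Ω) : EReal :=
  ⨆ f ∈ F, ((empiricalSq μ X f ω : ℝ) : EReal)

/-- `φ(x) = 2 ^ min(√N x, x²) - 1`. -/
noncomputable def bernsteinPhi (N : ℕ) (x : ℝ) : ℝ :=
  (2 : ℝ) ^ (min (Real.sqrt N * x) (x ^ 2)) - 1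

/-- The inverse function of `φ` on `[0, ∞)`; see the two lemmas below. -/
noncomputable def bernsteinPhiInv (N : ℕ) (y : ℝ) : ℝ :=
  max (Real.logb 2 (1 + y) / Real.sqrt N) (Real.sqrt (Real.logb 2 (1 + y)))

theorem bernsteinPhiInv_bernsteinPhi (N : ℕ) (hN : 1 ≤ N) (x : ℝ) (hx : 0 ≤ x) :
    bernsteinPhiInv N (bernsteinPhi N x) = x := by
  have hs : 0 < Real.sqrt N := Real.sqrt_pos.2 (by exact_mod_cast hN)
  have h1 : Real.logb 2 (1 + bernsteinPhi N x) = min (Real.sqrt N * x) (x ^ 2) := by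
    unfold bernsteinPhi
    rw [add_sub_cancel, Real.logb_rpow (by norm_num) (by norm_num)]
  unfold bernsteinPhiInv
  rw [h1]
  rcases le_total x (Real.sqrt N) with h | h
  · rw [min_eq_right (by nlinarith), Real.sqrt_sq hx, max_eq_right]
    rw [div_le_iff₀ hs]; nlinarith
  · rw [min_eq_left (by nlinarith), mul_div_cancel_left₀ _ hs.ne', max_eq_left]
    rw [Real.sqrt_le_left hx]; nlinarith

theorem bernsteinPhi_bernsteinPhiInv (N : ℕ) (hN : 1 ≤ N) (y : ℝ) (hy : 0 ≤ y) :
    bernsteinPhi N (bernsteinPhiInv N y) = y := by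
  have hs : 0 < Real.sqrt N := Real.sqrt_pos.2 (by exact_mod_cast hN)
  have hL : 0 ≤ Real.logb 2 (1 + y) := Real.logb_nonneg (by norm_num) (by linarith)
  have key : min (Real.sqrt N * bernsteinPhiInv N y) (bernsteinPhiInv N y ^ 2)
      = Real.logb 2 (1 + y) := by
    unfold bernsteinPhiInv
    set L := Real.logb 2 (1 + y)
    have hr : 0 ≤ Real.sqrt L := Real.sqrt_nonneg L
    have hLL : Real.sqrt L * Real.sqrt L = L := Real.mul_self_sqrt hL
    rcases le_total (Real.sqrt L) (Real.sqrt N) with h | h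
    · rw [max_eq_right (by rw [div_le_iff₀ hs]; nlinarith), min_eq_right (by nlinarith)]
      nlinarith
    · have h2 : Real.sqrt L ≤ L / Real.sqrt N := by rw [le_div_iff₀ hs]; nlinarith
      have h3 : Real.sqrt N * (L / Real.sqrt N) = L := by field_simp
      rw [max_eq_left h2, h3, min_eq_left]
      nlinarith
  unfold bernsteinPhi
  rw [key, Real.rpow_logb (by norm_num) (by norm_num) (by linarith)]
  ring

/-! Put v_f = (f(X_1), …, f(X_N)), so that N S_N(f) = ‖v_f‖² - 𝔼‖v_f‖². Squares of sub-Gaussian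
variables are sub-exponential, and f² - g² = (f - g)(f + g) has scale of order d(f,g)α. Bernstein's
inequality (`measure_sum_centered_ge_le`) therefore bounds N(S_N(f) - S_N(g)) by a multiple of
d(f,g)α(√N q + q²) off an event of probability e^{-q²}. Nets of log-cardinality of order 4^n force q
of order 2^n.

While 2^n ≤ √N the term √N q dominates, and these links of the chain sum to order αγ₂√N. Beyond that
level q² would produce ∑ 4^n d, which γ₂ does not control. There the vectors are chained instead of
their squared norms: ‖v_f - v_g‖ is at most of order d(f,g)(√N + 2^n), hence of order 2^n d(f,g), so
the remaining displacement is of order γ₂. Expanding the square once costs γ₂² + γ₂‖v‖ with ‖v‖ of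
order α√N, and the change of expectation is of order αγ₂√N. This is `chain_bound`;
`measure_chain_le` adds the probability.

For a failure probability e^{-4^k} the chain starts at level k, where the net is handled by a union
bound at cost α²(√N 2^k + 4^k). The coefficient of the γ₂ terms then does not grow with k
(`measure_exists_gt_le`). Integrating these tails yields Z, hence (i), and Markov's inequality gives
(ii) for u ≥ 1. For u < 1 the bound e^{-u²} carries no prefactor, so another argument is needed: the
supremum is S_N at the root plus a nonnegative remainder whose moments are governed by γ₂, and a
one-sided Chebyshev inequality suffices (`measure_gt_le_of_root`). -/

/-! ### Sub-exponential variables and Bernstein's inequality -/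

section Subexponential

/-- `Y` is sub-exponential with scale `κ`: `𝔼 exp (|Y| / κ) ≤ 2`. -/
structure IsSubexp {Ω : Type u} [MeasurableSpace Ω] (μ : Measure Ω) (Y : Ω → ℝ) (κ : ℝ) :
    Prop where
  measurable : Measurable Y
  pos : 0 < κ
  integrable_exp : Integrable (fun ω => Real.exp (|Y ω| / κ)) μ
  integral_exp_le : ∫ ω, Real.exp (|Y ω| / κ) ∂μ ≤ 2

variable {Ω : Type u} [MeasurableSpace Ω] {μ : Measure Ω}

theorem IsSubexp.of_lintegral {Y : Ω → ℝ} {κ : ℝ} (hY : Measurable Y) (hκ : 0 < κ)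
    (h : ∫⁻ ω, ENNReal.ofReal (Real.exp (|Y ω| / κ)) ∂μ ≤ 2) : IsSubexp μ Y κ := by
  have hm : Measurable (fun ω => Real.exp (|Y ω| / κ)) := by fun_prop
  refine ⟨hY, hκ, ?_, ?_⟩
  · refine (lintegral_ofReal_ne_top_iff_integrable hm.aestronglyMeasurable
      (ae_of_all _ fun ω => (Real.exp_pos _).le)).1 (ne_top_of_le_ne_top (by simp) h)
  · rw [integral_eq_lintegral_of_nonneg_ae (ae_of_all _ fun ω => (Real.exp_pos _).le)
      hm.aestronglyMeasurable]
    exact ENNReal.toReal_le_of_le_ofReal (by norm_num) (by simpa using h)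

theorem IsSubexp.integrable_of_le {Y G : Ω → ℝ} {κ c : ℝ} (h : IsSubexp μ Y κ)
    (hG : Measurable G) (hb : ∀ ω, |G ω| ≤ c * Real.exp (|Y ω| / κ)) : Integrable G μ :=
  (h.integrable_exp.const_mul c).mono' hG.aestronglyMeasurable (ae_of_all _ hb)

theorem IsSubexp.integral_abs_le_of_le {Y G : Ω → ℝ} {κ c : ℝ} (h : IsSubexp μ Y κ) (hc : 0 ≤ c)
    (hG : Measurable G) (hb : ∀ ω, |G ω| ≤ c * Real.exp (|Y ω| / κ)) :
    ∫ ω, |G ω| ∂μ ≤ 2 * c := by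
  calc ∫ ω, |G ω| ∂μ ≤ ∫ ω, c * Real.exp (|Y ω| / κ) ∂μ :=
        integral_mono (h.integrable_of_le hG hb).abs (h.integrable_exp.const_mul c) hb
    _ ≤ 2 * c := by
        rw [integral_const_mul]
        nlinarith [h.integral_exp_le]

theorem IsSubexp.abs_le {Y : Ω → ℝ} {κ : ℝ} (h : IsSubexp μ Y κ) (ω : Ω) :
    |Y ω| ≤ κ * Real.exp (|Y ω| / κ) := by
  have h1 := Real.add_one_le_exp (|Y ω| / κ)
  have h2 : |Y ω| = κ * (|Y ω| / κ) := by field_simp [h.pos.ne']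
  have := h.pos
  nlinarith

theorem IsSubexp.sq_le {Y : Ω → ℝ} {κ : ℝ} (h : IsSubexp μ Y κ) (ω : Ω) :
    |Y ω ^ 2| ≤ 2 * κ ^ 2 * Real.exp (|Y ω| / κ) := by
  have h1 := Real.quadratic_le_exp_of_nonneg (div_nonneg (abs_nonneg (Y ω)) h.pos.le)
  have h2 : |Y ω| = κ * (|Y ω| / κ) := by have := h.pos.ne'; field_simp
  have h0 := h.pos
  have h3 : 0 ≤ |Y ω| / κ := by positivity
  rw [abs_of_nonneg (sq_nonneg _), ← sq_abs (Y ω), h2, mul_pow]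
  rw [← h2]
  have : (0:ℝ) < κ ^ 2 := by positivity
  nlinarith

theorem IsSubexp.integrable {Y : Ω → ℝ} {κ : ℝ} (h : IsSubexp μ Y κ) : Integrable Y μ :=
  h.integrable_of_le h.measurable h.abs_le

theorem IsSubexp.integral_abs_le {Y : Ω → ℝ} {κ : ℝ} (h : IsSubexp μ Y κ) :
    ∫ ω, |Y ω| ∂μ ≤ 2 * κ :=
  h.integral_abs_le_of_le h.pos.le h.measurable h.abs_le

theorem IsSubexp.integrable_sq {Y : Ω → ℝ} {κ : ℝ} (h : IsSubexp μ Y κ) :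
    Integrable (fun ω => Y ω ^ 2) μ :=
  h.integrable_of_le (h.measurable.pow_const 2) h.sq_le

theorem IsSubexp.integral_sq_le {Y : Ω → ℝ} {κ : ℝ} (h : IsSubexp μ Y κ) :
    ∫ ω, Y ω ^ 2 ∂μ ≤ 4 * κ ^ 2 := by
  have := h.integral_abs_le_of_le (by positivity) (h.measurable.pow_const 2) h.sq_le
  simp only [abs_pow, sq_abs] at this
  linarith

theorem IsSubexp.integrable_exp_mul {Y : Ω → ℝ} {κ t : ℝ} (h : IsSubexp μ Y κ)
    (ht : |t| * κ ≤ 1) : Integrable (fun ω => Real.exp (t * Y ω)) μ := by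
  have := h.measurable
  refine h.integrable_of_le (c := 1) (by fun_prop) fun ω => ?_
  rw [Real.abs_exp, one_mul, Real.exp_le_exp]
  have h0 := h.pos
  rw [le_div_iff₀ h0]
  calc t * Y ω * κ ≤ |t * Y ω| * κ := by gcongr; exact le_abs_self _
    _ = |t| * κ * |Y ω| := by rw [abs_mul]; ring
    _ ≤ |Y ω| := by nlinarith [abs_nonneg (Y ω)]

theorem exp_le_one_add_add_sq_mul_exp_abs (x : ℝ) :
    Real.exp x ≤ 1 + x + x ^ 2 * Real.exp |x| := by
  have h := Complex.norm_exp_sub_sum_le_norm_mul_exp (x : ℂ) 2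
  rw [Finset.sum_range_succ, Finset.sum_range_one] at h
  simp only [pow_zero, pow_one, Nat.factorial_zero, Nat.factorial_one, Nat.cast_one, div_one,
    Complex.norm_real, Real.norm_eq_abs, sq_abs] at h
  have h2 : ‖Complex.exp (x : ℂ) - (1 + (x : ℂ))‖ = |Real.exp x - (1 + x)| := by
    rw [← Complex.ofReal_exp, ← Complex.ofReal_one, ← Complex.ofReal_add, ← Complex.ofReal_sub,
      Complex.norm_real, Real.norm_eq_abs]
  rw [h2] at h
  have := le_abs_self (Real.exp x - (1 + x))
  linarith

/-- Second-order Taylor expansion of exp(tY): the restriction |t|κ ≤ 1/2 spends half of the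
exponential moment on the remainder, and the other half absorbs Y². Centring cancels the linear
term. -/
theorem IsSubexp.mgf_centered_le [IsProbabilityMeasure μ] {Y : Ω → ℝ} {κ t : ℝ}
    (h : IsSubexp μ Y κ) (ht : |t| * κ ≤ 1 / 2) :
    mgf (fun ω => Y ω - ∫ ω', Y ω' ∂μ) μ t ≤ Real.exp (16 * κ ^ 2 * t ^ 2) := by
  have h0 := h.pos
  set m := ∫ ω', Y ω' ∂μ with hm
  have hpt : ∀ ω, Real.exp (t * Y ω) ≤
      1 + t * Y ω + 8 * κ ^ 2 * t ^ 2 * Real.exp (|Y ω| / κ) := fun ω => by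
    refine (exp_le_one_add_add_sq_mul_exp_abs _).trans ?_
    have h1 : Real.exp |t * Y ω| ≤ Real.exp (|Y ω| / κ / 2) := by
      rw [Real.exp_le_exp, div_div, le_div_iff₀ (by positivity), abs_mul]
      nlinarith [abs_nonneg (Y ω)]
    have h3 : 0 ≤ |Y ω| / κ / 2 := by positivity
    have h4 : Y ω ^ 2 ≤ 8 * κ ^ 2 * Real.exp (|Y ω| / κ / 2) := by
      have h5 := Real.quadratic_le_exp_of_nonneg h3
      have h6 : Y ω ^ 2 = 4 * κ ^ 2 * (|Y ω| / κ / 2) ^ 2 := by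
        rw [div_pow, div_pow, sq_abs]; field_simp; norm_num
      rw [h6]
      have : (0:ℝ) < κ ^ 2 := by positivity
      nlinarith
    have h7 : Real.exp (|Y ω| / κ) = Real.exp (|Y ω| / κ / 2) * Real.exp (|Y ω| / κ / 2) := by
      rw [← Real.exp_add]; ring_nf
    have h8 : (t * Y ω) ^ 2 * Real.exp |t * Y ω| ≤
        8 * κ ^ 2 * t ^ 2 * Real.exp (|Y ω| / κ) := by
      rw [h7, mul_pow]
      calc t ^ 2 * Y ω ^ 2 * Real.exp |t * Y ω|
          ≤ t ^ 2 * (8 * κ ^ 2 * Real.exp (|Y ω| / κ / 2)) * Real.exp (|Y ω| / κ / 2) := by gcongr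
        _ = _ := by ring
    linarith
  have hi : ∫ ω, Real.exp (t * Y ω) ∂μ ≤ 1 + t * m + 16 * κ ^ 2 * t ^ 2 := by
    calc ∫ ω, Real.exp (t * Y ω) ∂μ
        ≤ ∫ ω, (1 + t * Y ω + 8 * κ ^ 2 * t ^ 2 * Real.exp (|Y ω| / κ)) ∂μ :=
          integral_mono (h.integrable_exp_mul (by linarith))
            (((integrable_const _).add (h.integrable.const_mul t)).add
              (h.integrable_exp.const_mul _)) hpt
      _ = 1 + t * m + 8 * κ ^ 2 * t ^ 2 * ∫ ω, Real.exp (|Y ω| / κ) ∂μ := by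
          rw [integral_add (f := fun ω => 1 + t * Y ω)
            ((integrable_const _).add (h.integrable.const_mul t))
            (h.integrable_exp.const_mul _), integral_add (integrable_const _)
            (h.integrable.const_mul t), integral_const_mul, integral_const_mul]
          simp [hm]
      _ ≤ _ := by
          have : 0 ≤ 8 * κ ^ 2 * t ^ 2 := by positivity
          nlinarith [h.integral_exp_le]
  calc mgf (fun ω => Y ω - m) μ t = Real.exp (-(t * m)) * ∫ ω, Real.exp (t * Y ω) ∂μ := by
        rw [mgf, ← integral_const_mul]
        congr 1 with ω
        rw [← Real.exp_add]; ring_nf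
    _ ≤ Real.exp (-(t * m)) * Real.exp (t * m + 16 * κ ^ 2 * t ^ 2) := by
        gcongr
        have := Real.add_one_le_exp (t * m + 16 * κ ^ 2 * t ^ 2)
        linarith
    _ = _ := by rw [← Real.exp_add]; ring_nf

variable [IsProbabilityMeasure μ] {N : ℕ} {Y : Fin N → Ω → ℝ} {κ : ℝ}

theorem measure_sum_ge_le_of_mgf_le (hm : ∀ i, Measurable (Y i)) (hY : iIndepFun Y μ) {t c : ℝ}
    (ht : 0 ≤ t) (hi : ∀ i, Integrable (fun ω => Real.exp (t * Y i ω)) μ)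
    (hc : ∀ i, mgf (Y i) μ t ≤ Real.exp c) (ε : ℝ) :
    μ {ω | ε ≤ ∑ i, Y i ω} ≤ ENNReal.ofReal (Real.exp (N * c - t * ε)) := by
  have h1 := measure_ge_le_exp_mul_mgf (X := ∑ i, Y i) (μ := μ) ε ht
    (hY.integrable_exp_mul_sum hm fun i _ => hi i)
  rw [hY.mgf_sum hm] at h1
  have h2 : ∏ i, mgf (Y i) μ t ≤ Real.exp (N * c) := by
    calc ∏ i, mgf (Y i) μ t ≤ ∏ _i : Fin N, Real.exp c :=
          Finset.prod_le_prod (fun i _ => mgf_nonneg) fun i _ => hc i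
      _ = Real.exp (N * c) := by simp [Real.exp_nat_mul]
  simp only [Finset.sum_apply] at h1
  rw [ENNReal.le_ofReal_iff_toReal_le (measure_ne_top _ _) (Real.exp_pos _).le]
  refine h1.trans ?_
  calc Real.exp (-t * ε) * ∏ i, mgf (Y i) μ t ≤ Real.exp (-t * ε) * Real.exp (N * c) := by gcongr
    _ = _ := by rw [← Real.exp_add]; ring_nf

/-- One-sided Bernstein inequality for independent sub-exponential variables. -/
theorem measure_sum_centered_ge_le (h : ∀ i, IsSubexp μ (Y i) κ) (hY : iIndepFun Y μ)
    (hN : 1 ≤ N) {q : ℝ} (hq : 0 ≤ q) :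
    μ {ω | 10 * κ * (Real.sqrt N * q + q ^ 2) ≤ ∑ i, (Y i ω - ∫ ω', Y i ω' ∂μ)} ≤
      ENNReal.ofReal (Real.exp (-q ^ 2)) := by
  have h0 : 0 < κ := (h ⟨0, hN⟩).pos
  have hs : 0 < Real.sqrt N := Real.sqrt_pos.2 (by exact_mod_cast hN)
  have hss : Real.sqrt N ^ 2 = N := Real.sq_sqrt (by positivity)
  have key : ∀ t : ℝ, 0 ≤ t → t * κ ≤ 1 / 2 →
      N * (16 * κ ^ 2 * t ^ 2) - t * (10 * κ * (Real.sqrt N * q + q ^ 2)) ≤ -q ^ 2 →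
      μ {ω | 10 * κ * (Real.sqrt N * q + q ^ 2) ≤ ∑ i, (Y i ω - ∫ ω', Y i ω' ∂μ)} ≤
      ENNReal.ofReal (Real.exp (-q ^ 2)) := fun t ht htκ hle => by
    have hat : |t| = t := abs_of_nonneg ht
    have hind : iIndepFun (fun i ω => Y i ω - ∫ ω', Y i ω' ∂μ) μ :=
      hY.comp (fun i x => x - ∫ ω', Y i ω' ∂μ) fun i => by fun_prop
    refine (measure_sum_ge_le_of_mgf_le (fun i => ?_) hind ht (fun i => ?_)
      (fun i => (h i).mgf_centered_le (by rwa [hat])) _).trans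
      (ENNReal.ofReal_le_ofReal (Real.exp_le_exp.2 hle))
    · exact (h i).measurable.sub_const _
    · have := ((h i).integrable_exp_mul (t := t) (by rw [hat]; linarith)).const_mul
        (Real.exp (-(t * ∫ ω', Y i ω' ∂μ)))
      refine this.congr (ae_of_all _ fun ω => ?_)
      simp only [← Real.exp_add]; ring_nf
  -- The exponent 16Nκ²t² - 10κt(√N q + q²) is made at most -q² by t = q/(2κ√N) as long as this
  -- respects tκ ≤ 1/2, and by the extreme value t = 1/(2κ) afterwards.
  rcases le_total q (Real.sqrt N) with hqN | hqN
  · refine key (q / Real.sqrt N / (2 * κ)) (by positivity) ?_ (le_of_eq_of_le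
      (b := 4 * q ^ 2 - 5 * q ^ 2 - 5 * q ^ 2 * (q / Real.sqrt N)) ?_ ?_)
    · have : q / Real.sqrt N ≤ 1 := by rw [div_le_one hs]; exact hqN
      rw [div_mul_eq_mul_div, div_le_iff₀ (by positivity)]
      nlinarith
    · generalize Real.sqrt N = s at *
      rw [← hss]; field_simp; ring
    · have : 0 ≤ q ^ 2 * (q / Real.sqrt N) := by positivity
      linarith
  · refine key (1 / (2 * κ)) (by positivity) (by field_simp; rfl) (le_of_eq_of_le
      (b := 4 * Real.sqrt N ^ 2 - 5 * (Real.sqrt N * q + q ^ 2)) ?_ ?_)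
    · rw [hss]; field_simp; ring
    · nlinarith

/-- Chernoff at t = 1/κ, where each factor is at most 2 ≤ e. Without centring the term κN is
unavoidable, but it is harmless for bounds on norms of sample vectors. -/
theorem measure_sum_ge_le (h : ∀ i, IsSubexp μ (Y i) κ) (hY : iIndepFun Y μ) (hN : 1 ≤ N)
    (q : ℝ) :
    μ {ω | κ * (N + q ^ 2) ≤ ∑ i, Y i ω} ≤ ENNReal.ofReal (Real.exp (-q ^ 2)) := by
  have h0 : 0 < κ := (h ⟨0, hN⟩).pos
  have hi : ∀ i, Integrable (fun ω => Real.exp (κ⁻¹ * Y i ω)) μ := fun i =>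
    (h i).integrable_exp_mul (by rw [abs_of_pos (by positivity)]; field_simp; rfl)
  refine (measure_sum_ge_le_of_mgf_le (fun i => (h i).measurable) hY (t := κ⁻¹) (c := 1)
    (by positivity) hi (fun i => ?_) _).trans (ENNReal.ofReal_le_ofReal (Real.exp_le_exp.2 ?_))
  · calc mgf (Y i) μ κ⁻¹ ≤ ∫ ω, Real.exp (|Y i ω| / κ) ∂μ := by
          refine integral_mono (hi i) (h i).integrable_exp fun ω => ?_
          rw [Real.exp_le_exp, inv_mul_eq_div]
          gcongr
          exact le_abs_self _
      _ ≤ 2 := (h i).integral_exp_le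
      _ ≤ _ := by have := Real.add_one_le_exp 1; linarith
  · apply le_of_eq; field_simp; ring

theorem integral_sum_centered_sq_le (h : ∀ i, IsSubexp μ (Y i) κ) (hY : iIndepFun Y μ) :
    Integrable (fun ω => (∑ i, (Y i ω - ∫ ω', Y i ω' ∂μ)) ^ 2) μ ∧
      ∫ ω, (∑ i, (Y i ω - ∫ ω', Y i ω' ∂μ)) ^ 2 ∂μ ≤ N * (4 * κ ^ 2) := by
  have hL : ∀ i, MemLp (Y i) 2 μ := fun i =>
    (memLp_two_iff_integrable_sq (h i).measurable.aestronglyMeasurable).2 (h i).integrable_sq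
  have hv := IndepFun.variance_sum (μ := μ) (X := Y) (s := Finset.univ) (fun i _ => hL i)
    fun i _ j _ hij => hY.indepFun hij
  have hLs : MemLp (∑ i, Y i) 2 μ := memLp_finsetSum' _ fun i _ => hL i
  have he : ∀ ω, (∑ i, (Y i ω - ∫ ω', Y i ω' ∂μ)) =
      (∑ i, Y i) ω - ∫ ω', (∑ i, Y i) ω' ∂μ := fun ω => by
    simp only [Finset.sum_apply]
    rw [integral_finsetSum _ fun i _ => (h i).integrable, Finset.sum_sub_distrib]
  simp only [he]
  refine ⟨(hLs.sub (memLp_const _)).integrable_sq, ?_⟩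
  rw [← variance_eq_integral hLs.aestronglyMeasurable.aemeasurable, hv]
  calc ∑ i, Var[Y i; μ] ≤ ∑ _i : Fin N, 4 * κ ^ 2 := Finset.sum_le_sum fun i _ =>
        (variance_le_expectation_sq (h i).measurable.aestronglyMeasurable).trans
          (by simpa using (h i).integral_sq_le)
    _ = _ := by simp

end Subexponential

/-! ### Squares of a sub-Gaussian family -/

section SubgaussianFamily

variable {Ω : Type u} [MeasurableSpace Ω] {μ : Measure Ω}

theorem subgaussianTail_le {u D D' : ℝ} (hD : 0 ≤ D) (hDD' : D ≤ D') :
    subgaussianTail u D ≤ 2 * Real.exp (-(u ^ 2 / D' ^ 2)) := by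
  unfold subgaussianTail
  split_ifs with h
  · positivity
  · have : 0 < D := lt_of_le_of_ne hD (Ne.symm h)
    gcongr

theorem lintegral_Ioi_one_inv_cube :
    ∫⁻ t in Set.Ioi (1 : ℝ), ENNReal.ofReal (2 * t ^ (-3 : ℝ)) = 1 := by
  rw [← ofReal_integral_eq_lintegral_ofReal]
  · rw [integral_const_mul, integral_Ioi_rpow_of_lt (by norm_num) (by norm_num)]
    norm_num
  · exact (integrableOn_Ioi_rpow_of_lt (by norm_num) (by norm_num)).const_mul 2
  · filter_upwards [ae_restrict_mem measurableSet_Ioi] with t ht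
    have : (0:ℝ) < t := lt_trans one_pos ht
    positivity

theorem IsSubexp.sq_of_tail [IsProbabilityMeasure μ] {U : Ω → ℝ} (hU : Measurable U) {D D' : ℝ}
    (hD : 0 ≤ D) (hDD' : D ≤ D') (hD' : 0 < D')
    (h : ∀ u : ℝ, 0 < u → μ.real {ω | u ≤ |U ω|} ≤ subgaussianTail u D) :
    IsSubexp μ (fun ω => U ω ^ 2) (3 * D' ^ 2) := by
  refine .of_lintegral (hU.pow_const 2) (by positivity) ?_
  have hm : Measurable (fun ω => Real.exp (|U ω ^ 2| / (3 * D' ^ 2))) := by fun_prop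
  rw [lintegral_eq_lintegral_meas_le μ (ae_of_all _ fun ω => (Real.exp_pos _).le) hm.aemeasurable,
    ← Set.Ioc_union_Ioi_eq_Ioi zero_le_one,
    lintegral_union measurableSet_Ioi Set.Ioc_disjoint_Ioi_same]
  refine (add_le_add ?_ (?_ : _ ≤ (1 : ℝ≥0∞))).trans_eq one_add_one_eq_two
  · calc ∫⁻ t in Set.Ioc (0:ℝ) 1, μ {a | t ≤ Real.exp (|U a ^ 2| / (3 * D' ^ 2))}
        ≤ ∫⁻ _t in Set.Ioc (0:ℝ) 1, 1 := lintegral_mono fun t => prob_le_one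
      _ = 1 := by simp
  · rw [← lintegral_Ioi_one_inv_cube]
    refine setLIntegral_mono' measurableSet_Ioi fun t ht => ?_
    have ht1 : (1:ℝ) < t := ht
    have hl : 0 < Real.log t := Real.log_pos ht1
    -- At this level the sub-Gaussian tail equals 2t⁻³, whose integral over (1, ∞) is 1; the levels
    -- t ≤ 1 contribute at most the other 1.
    set u := D' * Real.sqrt (3 * Real.log t) with hu
    have hu0 : 0 < u := by positivity
    have hu2 : u ^ 2 = D' ^ 2 * (3 * Real.log t) := by
      rw [hu, mul_pow, Real.sq_sqrt (by positivity)]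
    have hsub : {a | t ≤ Real.exp (|U a ^ 2| / (3 * D' ^ 2))} ⊆ {ω | u ≤ |U ω|} := fun a ha => by
      simp only [Set.mem_ofPred_eq] at ha ⊢
      rw [← Real.log_le_iff_le_exp (by linarith), le_div_iff₀ (by positivity),
        abs_of_nonneg (sq_nonneg _)] at ha
      exact (sq_le_sq₀ hu0.le (abs_nonneg _)).1 (by rw [sq_abs]; linarith)
    refine (measure_mono hsub).trans ?_
    rw [ENNReal.le_ofReal_iff_toReal_le (measure_ne_top _ _) (by positivity)]
    refine ((h u hu0).trans (subgaussianTail_le hD hDD')).trans (le_of_eq ?_)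
    rw [hu2, Real.rpow_def_of_pos (by linarith)]
    congr 2
    field_simp

variable {𝒳 : Type v} [MeasurableSpace 𝒳]

/-- The sample `X` is independent, and the increments of the family `F ∪ {0}` along it are
sub-Gaussian with respect to the distance `d`. -/
structure IsSubgaussianFamily {N : ℕ} (μ : Measure Ω) (X : Fin N → Ω → 𝒳) (F : Set (𝒳 → ℝ))
    (d : (𝒳 → ℝ) → (𝒳 → ℝ) → ℝ) : Prop where
  one_le : 1 ≤ N
  measurable_sample : ∀ i, Measurable (X i)
  indep : iIndepFun X μ
  measurable : ∀ f ∈ F, Measurable f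
  dist : IsDistOn d (insert 0 F)
  increment : ∀ f ∈ F, ∀ g ∈ F, ∀ i, ∀ u : ℝ, 0 < u →
    μ.real {ω | u ≤ |f (X i ω) - g (X i ω)|} ≤ subgaussianTail u (d f g)
  tail : ∀ f ∈ F, ∀ i, ∀ u : ℝ, 0 < u →
    μ.real {ω | u ≤ |f (X i ω)|} ≤ subgaussianTail u (d f 0)

namespace IsSubgaussianFamily

variable {N : ℕ} {X : Fin N → Ω → 𝒳} {F : Set (𝒳 → ℝ)}
  {d : (𝒳 → ℝ) → (𝒳 → ℝ) → ℝ} {f g : 𝒳 → ℝ} {D α q : ℝ}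

theorem dist_nonneg (h : IsSubgaussianFamily μ X F d) (hf : f ∈ F) (hg : g ∈ F) : 0 ≤ d f g :=
  h.dist.nonneg f (.inr hf) g (.inr hg)

theorem measurable_comp (h : IsSubgaussianFamily μ X F d) (hf : f ∈ F) (i : Fin N) :
    Measurable (fun ω => f (X i ω)) := (h.measurable f hf).comp (h.measurable_sample i)

theorem mul_empiricalSq (h : IsSubgaussianFamily μ X F d) (f : 𝒳 → ℝ) (ω : Ω) :
    N * empiricalSq μ X f ω = ∑ i, (f (X i ω) ^ 2 - ∫ ω', f (X i ω') ^ 2 ∂μ) := by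
  have : (N : ℝ) ≠ 0 := by have := h.one_le; positivity
  unfold empiricalSq
  field_simp

theorem measurable_empiricalSq (h : IsSubgaussianFamily μ X F d) (hf : f ∈ F) :
    Measurable (empiricalSq μ X f) := by
  unfold empiricalSq
  refine Measurable.const_mul (Finset.measurable_sum _ fun i _ => ?_) _
  exact ((h.measurable_comp hf i).pow_const 2).sub_const _

variable [IsProbabilityMeasure μ]

theorem isSubexp_sub_sq (h : IsSubgaussianFamily μ X F d) (hf : f ∈ F) (hg : g ∈ F)
    (hD : d f g ≤ D) (hD0 : 0 < D) (i : Fin N) :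
    IsSubexp μ (fun ω => (f (X i ω) - g (X i ω)) ^ 2) (3 * D ^ 2) :=
  .sq_of_tail ((h.measurable_comp hf i).sub (h.measurable_comp hg i)) (h.dist_nonneg hf hg) hD hD0
    (h.increment f hf g hg i)

theorem isSubexp_sq (h : IsSubgaussianFamily μ X F d) (hf : f ∈ F) (hα : d f 0 ≤ α) (hα0 : 0 < α)
    (i : Fin N) : IsSubexp μ (fun ω => f (X i ω) ^ 2) (3 * α ^ 2) :=
  .sq_of_tail (h.measurable_comp hf i) (h.dist.nonneg f (.inr hf) 0 (.inl rfl)) hα hα0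
    (h.tail f hf i)

/-- Factor f² - g² = (f - g)(f + g). The arithmetic-geometric inequality, with f - g measured in
units of D and f + g in units of α, bounds the exponent by an average of those of (f - g)², f² and
g²; convexity of exp then averages the three exponential moments. The majorants D and α are kept
positive because the distances themselves may vanish. -/
theorem isSubexp_sq_sub_sq (h : IsSubgaussianFamily μ X F d) (hf : f ∈ F) (hg : g ∈ F)
    (hD : d f g ≤ D) (hD0 : 0 < D) (hfα : d f 0 ≤ α) (hgα : d g 0 ≤ α) (hα0 : 0 < α)
    (i : Fin N) : IsSubexp μ (fun ω => f (X i ω) ^ 2 - g (X i ω) ^ 2) (12 * D * α) := by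
  have h1 := h.isSubexp_sub_sq hf hg hD hD0 i
  have h2 := h.isSubexp_sq hf hfα hα0 i
  have h3 := h.isSubexp_sq hg hgα hα0 i
  have hconv : ∀ x y : ℝ, Real.exp ((x + y) / 2) ≤ (Real.exp x + Real.exp y) / 2 := fun x y => by
    have hx : Real.exp x = Real.exp (x / 2) ^ 2 := by rw [← Real.exp_nat_mul]; ring_nf
    have hy : Real.exp y = Real.exp (y / 2) ^ 2 := by rw [← Real.exp_nat_mul]; ring_nf
    rw [add_div, Real.exp_add, hx, hy]
    nlinarith [sq_nonneg (Real.exp (x / 2) - Real.exp (y / 2))]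
  have hm : Measurable (fun ω => f (X i ω) ^ 2 - g (X i ω) ^ 2) :=
    ((h.measurable_comp hf i).pow_const 2).sub ((h.measurable_comp hg i).pow_const 2)
  set G : Ω → ℝ := fun ω => (Real.exp (|(f (X i ω) - g (X i ω)) ^ 2| / (3 * D ^ 2)) +
      (Real.exp (|f (X i ω) ^ 2| / (3 * α ^ 2)) +
        Real.exp (|g (X i ω) ^ 2| / (3 * α ^ 2))) / 2) / 2 with hG
  have hGi : Integrable G μ := (h1.integrable_exp.add
    ((h2.integrable_exp.add h3.integrable_exp).div_const 2)).div_const 2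
  have hb : ∀ ω, Real.exp (|f (X i ω) ^ 2 - g (X i ω) ^ 2| / (12 * D * α)) ≤ G ω := fun ω => by
    set a := f (X i ω)
    set b := g (X i ω)
    have e1 : |a ^ 2 - b ^ 2| / (12 * D * α) ≤
        (|(a - b) ^ 2| / (3 * D ^ 2) + (|a ^ 2| / (3 * α ^ 2) + |b ^ 2| / (3 * α ^ 2)) / 2) / 2 := by
      simp only [abs_pow, sq_abs]
      have e2 : a ^ 2 - b ^ 2 = (a - b) * (a + b) := by ring
      rw [e2, abs_mul]
      have e3 : (a + b) ^ 2 ≤ 2 * (a ^ 2 + b ^ 2) := by nlinarith [sq_nonneg (a - b)]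
      have e4 : |a - b| * |a + b| / (12 * D * α) = (|a - b| / D) * (|a + b| / α) / 12 := by
        field_simp
      have e5 : (|a - b| / D) ^ 2 = (a - b) ^ 2 / D ^ 2 := by rw [div_pow, sq_abs]
      have e6 : (|a + b| / α) ^ 2 ≤ 2 * (a ^ 2 + b ^ 2) / α ^ 2 := by
        rw [div_pow, sq_abs]; gcongr
      have e7 : ((a - b) ^ 2 / (3 * D ^ 2) + (a ^ 2 / (3 * α ^ 2) + b ^ 2 / (3 * α ^ 2)) / 2) / 2 =
        (a - b) ^ 2 / D ^ 2 / 6 + 2 * (a ^ 2 + b ^ 2) / α ^ 2 / 24 := by field_simp; ring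
      rw [e4, e7]
      have e8 : 0 ≤ (a - b) ^ 2 / D ^ 2 := by positivity
      nlinarith [sq_nonneg ((|a - b| / D) - (|a + b| / α))]
    calc _ ≤ _ := Real.exp_le_exp.2 e1
      _ ≤ _ := hconv _ _
      _ ≤ G ω := by simp only [hG]; gcongr; exact hconv _ _
  have hi : Integrable (fun ω => Real.exp (|f (X i ω) ^ 2 - g (X i ω) ^ 2| / (12 * D * α))) μ :=
    hGi.mono' (hm.abs.div_const _).exp.aestronglyMeasurable (ae_of_all _ fun ω => by
      rw [Real.norm_eq_abs, Real.abs_exp]; exact hb ω)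
  refine ⟨hm, by positivity, hi, (integral_mono hi hGi hb).trans ?_⟩
  simp only [hG]
  have h23 : Integrable (fun ω => (Real.exp (|f (X i ω) ^ 2| / (3 * α ^ 2)) +
      Real.exp (|g (X i ω) ^ 2| / (3 * α ^ 2))) / 2) μ :=
    (h2.integrable_exp.add h3.integrable_exp).div_const 2
  rw [integral_div, integral_add h1.integrable_exp h23, integral_div,
    integral_add h2.integrable_exp h3.integrable_exp]
  linarith [h1.integral_exp_le, h2.integral_exp_le, h3.integral_exp_le]

theorem integrable_sq (h : IsSubgaussianFamily μ X F d) (hf : f ∈ F) (i : Fin N) :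
    Integrable (fun ω => f (X i ω) ^ 2) μ :=
  (h.isSubexp_sq hf (α := d f 0 + 1) (by linarith)
    (by linarith [h.dist.nonneg f (.inr hf) 0 (.inl rfl)]) i).integrable

theorem measure_empiricalSq_sub_ge (h : IsSubgaussianFamily μ X F d) (hf : f ∈ F) (hg : g ∈ F)
    (hD : d f g ≤ D) (hD0 : 0 < D) (hfα : d f 0 ≤ α) (hgα : d g 0 ≤ α) (hα0 : 0 < α)
    (hq : 0 ≤ q) :
    μ {ω | 120 * D * α * (Real.sqrt N * q + q ^ 2) ≤
      N * empiricalSq μ X f ω - N * empiricalSq μ X g ω} ≤ ENNReal.ofReal (Real.exp (-q ^ 2)) := by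
  have hind : iIndepFun (fun i ω => f (X i ω) ^ 2 - g (X i ω) ^ 2) μ :=
    h.indep.comp (fun _ x => f x ^ 2 - g x ^ 2) fun _ =>
      ((h.measurable f hf).pow_const 2).sub ((h.measurable g hg).pow_const 2)
  have := measure_sum_centered_ge_le (h.isSubexp_sq_sub_sq hf hg hD hD0 hfα hgα hα0) hind
    h.one_le hq
  convert this using 5 with ω
  · ring
  · rw [h.mul_empiricalSq, h.mul_empiricalSq, ← Finset.sum_sub_distrib]
    refine Finset.sum_congr rfl fun i _ => ?_
    rw [integral_sub (h.integrable_sq hf i) (h.integrable_sq hg i)]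
    ring

theorem measure_empiricalSq_ge (h : IsSubgaussianFamily μ X F d) (hf : f ∈ F) (hfα : d f 0 ≤ α)
    (hα0 : 0 < α) (hq : 0 ≤ q) :
    μ {ω | 30 * α ^ 2 * (Real.sqrt N * q + q ^ 2) ≤ N * empiricalSq μ X f ω} ≤
      ENNReal.ofReal (Real.exp (-q ^ 2)) := by
  have hind : iIndepFun (fun i ω => f (X i ω) ^ 2) μ :=
    h.indep.comp (fun _ x => f x ^ 2) fun _ => (h.measurable f hf).pow_const 2
  have := measure_sum_centered_ge_le (h.isSubexp_sq hf hfα hα0) hind h.one_le hq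
  convert this using 5 with ω
  · ring
  · rw [h.mul_empiricalSq]

theorem measure_sum_sub_sq_ge (h : IsSubgaussianFamily μ X F d) (hf : f ∈ F) (hg : g ∈ F)
    (hD : d f g ≤ D) (hD0 : 0 < D) (q : ℝ) :
    μ {ω | 3 * D ^ 2 * (N + q ^ 2) ≤ ∑ i, (f (X i ω) - g (X i ω)) ^ 2} ≤
      ENNReal.ofReal (Real.exp (-q ^ 2)) :=
  measure_sum_ge_le (h.isSubexp_sub_sq hf hg hD hD0)
    (h.indep.comp (fun _ x => (f x - g x) ^ 2) fun _ =>
      ((h.measurable f hf).sub (h.measurable g hg)).pow_const 2) h.one_le q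

theorem measure_sum_sq_ge (h : IsSubgaussianFamily μ X F d) (hf : f ∈ F) (hfα : d f 0 ≤ α)
    (hα0 : 0 < α) (q : ℝ) :
    μ {ω | 3 * α ^ 2 * (N + q ^ 2) ≤ ∑ i, f (X i ω) ^ 2} ≤ ENNReal.ofReal (Real.exp (-q ^ 2)) :=
  measure_sum_ge_le (h.isSubexp_sq hf hfα hα0)
    (h.indep.comp (fun _ x => f x ^ 2) fun _ => (h.measurable f hf).pow_const 2) h.one_le q

theorem abs_sum_integral_sq_sub_le (h : IsSubgaussianFamily μ X F d) (hf : f ∈ F) (hg : g ∈ F)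
    (hD : d f g ≤ D) (hD0 : 0 < D) (hfα : d f 0 ≤ α) (hgα : d g 0 ≤ α) (hα0 : 0 < α) :
    |∑ i, ∫ ω, f (X i ω) ^ 2 ∂μ - ∑ i, ∫ ω, g (X i ω) ^ 2 ∂μ| ≤ 24 * N * D * α := by
  rw [← Finset.sum_sub_distrib]
  calc _ ≤ ∑ i, |∫ ω, f (X i ω) ^ 2 ∂μ - ∫ ω, g (X i ω) ^ 2 ∂μ| := Finset.abs_sum_le_sum_abs _ _
    _ ≤ ∑ _i : Fin N, 2 * (12 * D * α) := Finset.sum_le_sum fun i _ => by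
        rw [← integral_sub (h.integrable_sq hf i) (h.integrable_sq hg i)]
        exact abs_integral_le_integral_abs.trans
          (h.isSubexp_sq_sub_sq hf hg hD hD0 hfα hgα hα0 i).integral_abs_le
    _ = _ := by simp; ring

theorem lintegral_abs_sub_le (h : IsSubgaussianFamily μ X F d) (hf : f ∈ F) (hg : g ∈ F)
    (hD : d f g ≤ D) (hD0 : 0 < D) (i : Fin N) :
    ∫⁻ ω, ENNReal.ofReal |f (X i ω) - g (X i ω)| ∂μ ≤ ENNReal.ofReal (4 * D) := by
  have h1 := h.isSubexp_sub_sq hf hg hD hD0 i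
  have hb : ∀ ω, |f (X i ω) - g (X i ω)| ≤
      2 * D * Real.exp (|(f (X i ω) - g (X i ω)) ^ 2| / (3 * D ^ 2)) := fun ω => by
    set a := f (X i ω) - g (X i ω)
    have e1 := Real.add_one_le_exp (|a ^ 2| / (3 * D ^ 2))
    have e2 : |a| = D * (|a| / D) := by field_simp
    have e3 : |a ^ 2| / (3 * D ^ 2) = (|a| / D) ^ 2 / 3 := by rw [abs_pow]; field_simp
    rw [e3] at e1 ⊢
    have e4 : |a| / D ≤ 2 * Real.exp ((|a| / D) ^ 2 / 3) := by
      nlinarith [sq_nonneg (|a| / D - 1)]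
    calc |a| = D * (|a| / D) := e2
      _ ≤ D * (2 * Real.exp ((|a| / D) ^ 2 / 3)) := by gcongr
      _ = _ := by ring
  have hm : Measurable fun ω => f (X i ω) - g (X i ω) :=
    (h.measurable_comp hf i).sub (h.measurable_comp hg i)
  rw [← ofReal_integral_eq_lintegral_ofReal (h1.integrable_of_le hm hb).abs
    (ae_of_all _ fun ω => abs_nonneg _)]
  refine ENNReal.ofReal_le_ofReal ?_
  linarith [h1.integral_abs_le_of_le (by positivity) hm hb]

theorem integral_mul_empiricalSq_sq_le (h : IsSubgaussianFamily μ X F d) (hf : f ∈ F)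
    (hfα : d f 0 ≤ α) (hα0 : 0 < α) :
    Integrable (fun ω => (N * empiricalSq μ X f ω) ^ 2) μ ∧
      ∫ ω, (N * empiricalSq μ X f ω) ^ 2 ∂μ ≤ 36 * N * α ^ 4 := by
  have := integral_sum_centered_sq_le (h.isSubexp_sq hf hfα hα0)
    (h.indep.comp (fun _ x => f x ^ 2) fun _ => (h.measurable f hf).pow_const 2)
  simp only [h.mul_empiricalSq]
  refine ⟨this.1, this.2.trans (le_of_eq (by ring))⟩

theorem integral_mul_empiricalSq (h : IsSubgaussianFamily μ X F d) (hf : f ∈ F) :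
    Integrable (fun ω => N * empiricalSq μ X f ω) μ ∧
      ∫ ω, N * empiricalSq μ X f ω ∂μ = 0 := by
  simp only [h.mul_empiricalSq]
  have hi : ∀ i, Integrable (fun ω => f (X i ω) ^ 2 - ∫ ω', f (X i ω') ^ 2 ∂μ) μ := fun i =>
    (h.integrable_sq hf i).sub (integrable_const _)
  refine ⟨integrable_finsetSum _ fun i _ => hi i, ?_⟩
  rw [integral_finsetSum _ fun i _ => hi i]
  refine Finset.sum_eq_zero fun i _ => ?_
  rw [integral_sub (h.integrable_sq hf i) (integrable_const _)]
  simp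

end IsSubgaussianFamily

end SubgaussianFamily

/-! ### Deterministic chaining in a seminormed space -/

section Chaining

open Filter Topology

/-- Deterministic part of the chaining argument: below the level where `2 ^ n` reaches `√N` the
increments of `‖v n‖² - e n` are summed, above it those of `v n`. -/
theorem chain_bound {E : Type*} [SeminormedAddCommGroup E] {x : ℕ → E} {y : E}
    (hlim : Tendsto x atTop (𝓝 y)) {e δ : ℕ → ℝ} {e' α γ l : ℝ} {N n₀ : ℕ} (hN : 1 ≤ N)
    (hl : 1 ≤ l) (hα : 0 ≤ α) (hγ : 0 ≤ γ) (hδ0 : ∀ n, 0 ≤ δ n)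
    (hδ : ∀ n, ∑ i ∈ Finset.range n, 2 ^ i * δ i ≤ 4 * γ)
    (h1 : ∀ n ≥ n₀, (‖x (n + 1)‖ ^ 2 - e (n + 1)) - (‖x n‖ ^ 2 - e n) ≤
      120 * δ n * α * (Real.sqrt N * (4 * l * 2 ^ n) + (4 * l * 2 ^ n) ^ 2))
    (h2 : ∀ n ≥ n₀, ‖x (n + 1) - x n‖ ≤ 2 * δ n * (Real.sqrt N + 4 * l * 2 ^ n))
    (h3 : ∀ n ≥ n₀, ‖x n‖ ≤ 2 * α * (Real.sqrt N + 4 * l * 2 ^ n))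
    (h4 : ∀ n, (e n - e') * 2 ^ n ≤ 24 * N * α * γ) :
    ‖y‖ ^ 2 - e' - (‖x n₀‖ ^ 2 - e n₀) ≤
      11000 * l ^ 2 * (γ ^ 2 + α * γ * Real.sqrt N + α * γ * 2 ^ n₀) := by
  have hN' : (1 : ℝ) ≤ Real.sqrt N := Real.one_le_sqrt.2 (by exact_mod_cast hN)
  have hss : Real.sqrt N ^ 2 = N := Real.sq_sqrt (by positivity)
  -- Here 2^m ≤ √N < 2^(m+1): the level at which the two regimes of Bernstein's inequality meet.
  obtain ⟨m, hm1, hm2⟩ := exists_nat_pow_near hN' (one_lt_two : (1 : ℝ) < 2)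
  set s := Real.sqrt N with hs
  set M := max n₀ m with hM
  have hll : l ≤ l ^ 2 := by nlinarith
  have hIco : ∀ a b, ∑ i ∈ Finset.Ico a b, 2 ^ i * δ i ≤ 4 * γ := fun a b =>
    (Finset.sum_le_sum_of_subset_of_nonneg (fun i hi => by simp at hi ⊢; omega)
      fun i _ _ => mul_nonneg (by positivity) (hδ0 i)).trans (hδ b)
  -- Levels with 2^n ≤ √N: the quadratic Bernstein term (4l2^n)² is at most 16l²√N 2^n, so every
  -- link costs a multiple of √N α 2^n δ n.
  have step1 : (‖x M‖ ^ 2 - e M) - (‖x n₀‖ ^ 2 - e n₀) ≤ 9600 * l ^ 2 * (α * γ * s) := by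
    rw [← Finset.sum_Ico_sub (fun n => ‖x n‖ ^ 2 - e n) (le_max_left n₀ m)]
    calc _ ≤ ∑ n ∈ Finset.Ico n₀ M, 2400 * l ^ 2 * α * s * (2 ^ n * δ n) := by
          refine Finset.sum_le_sum fun n hn => ?_
          rw [Finset.mem_Ico] at hn
          refine (h1 n hn.1).trans ?_
          have hnm : (2:ℝ) ^ n ≤ s :=
            (pow_le_pow_right₀ one_le_two (by omega : n ≤ m)).trans hm1
          have h2n : (0:ℝ) < 2 ^ n := by positivity
          have e1 : s * (4 * l * 2 ^ n) + (4 * l * 2 ^ n) ^ 2 ≤ 20 * l ^ 2 * s * 2 ^ n := by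
            have : s * (4 * l * 2 ^ n) ≤ s * (4 * l ^ 2 * 2 ^ n) := by gcongr
            have : (4 * l * 2 ^ n) ^ 2 ≤ 16 * l ^ 2 * (2 ^ n * s) := by
              rw [mul_pow, mul_pow, sq ((2:ℝ) ^ n)]; norm_num; gcongr
            nlinarith
          have := hδ0 n
          calc _ ≤ 120 * δ n * α * (20 * l ^ 2 * s * 2 ^ n) := by gcongr
            _ = _ := by ring
      _ = 2400 * l ^ 2 * α * s * ∑ n ∈ Finset.Ico n₀ M, 2 ^ n * δ n := by rw [Finset.mul_sum]
      _ ≤ 2400 * l ^ 2 * α * s * (4 * γ) := by gcongr; exact hIco _ _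
      _ = _ := by ring
  have hs2M : s ≤ 2 * 2 ^ M := by
    have : (2:ℝ) ^ m ≤ 2 ^ M := pow_le_pow_right₀ one_le_two (le_max_right _ _)
    rw [pow_succ] at hm2
    linarith
  -- From level M on, √N ≤ 2·2^n, so displacements are at most 12l·2^n δ n. The bound for finite
  -- chains passes to the limit y.
  have step2 : ‖y - x M‖ ≤ 48 * l * γ := by
    refine le_of_tendsto ((hlim.sub_const (x M)).norm) ?_
    filter_upwards [eventually_ge_atTop M] with k hk
    rw [← Finset.sum_Ico_sub x hk]
    calc _ ≤ ∑ n ∈ Finset.Ico M k, 12 * l * (2 ^ n * δ n) := by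
          refine (norm_sum_le _ _).trans (Finset.sum_le_sum fun n hn => ?_)
          rw [Finset.mem_Ico] at hn
          refine (h2 n ((le_max_left _ _).trans hn.1)).trans ?_
          have : (2:ℝ) ^ M ≤ 2 ^ n := pow_le_pow_right₀ one_le_two hn.1
          have e1 : s + 4 * l * 2 ^ n ≤ 6 * l * 2 ^ n := by nlinarith
          have := hδ0 n
          calc _ ≤ 2 * δ n * (6 * l * 2 ^ n) := by gcongr
            _ = _ := by ring
      _ = 12 * l * ∑ n ∈ Finset.Ico M k, 2 ^ n * δ n := by rw [Finset.mul_sum]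
      _ ≤ 12 * l * (4 * γ) := by gcongr; exact hIco _ _
      _ = _ := by ring
  have step3 : ‖x M‖ ≤ 10 * α * l * (s + 2 ^ n₀) := by
    refine (h3 M (le_max_left _ _)).trans ?_
    have e0 : (2:ℝ) ^ M ≤ s + 2 ^ n₀ := by
      have : (0:ℝ) < 2 ^ n₀ := by positivity
      rcases max_choice n₀ m with h | h <;> rw [hM, h] <;> linarith
    have : (0:ℝ) < 2 ^ n₀ := by positivity
    have e1 : s + 4 * l * 2 ^ M ≤ 5 * l * (s + 2 ^ n₀) := by nlinarith
    calc _ ≤ 2 * α * (5 * l * (s + 2 ^ n₀)) := by gcongr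
      _ = _ := by ring
  -- The factor N becomes √N because √N ≤ 2·2^M.
  have step4 : e M - e' ≤ 48 * (α * γ * s) := by
    have h := h4 M
    rw [← hss] at h
    have h2M : (0:ℝ) < 2 ^ M := by positivity
    refine le_of_mul_le_mul_right (h.trans ?_) h2M
    have : 0 ≤ 24 * s * α * γ := by positivity
    nlinarith
  have step5 : ‖y‖ ^ 2 ≤ ‖x M‖ ^ 2 + 960 * l ^ 2 * (α * γ * (s + 2 ^ n₀)) + 2304 * l ^ 2 * γ ^ 2 := by
    have e1 : ‖y‖ ≤ ‖x M‖ + 48 * l * γ := by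
      have := norm_add_le (x M) (y - x M)
      rw [add_sub_cancel] at this
      linarith
    have h48 : 0 ≤ 48 * l * γ := by positivity
    calc ‖y‖ ^ 2 ≤ (‖x M‖ + 48 * l * γ) ^ 2 := by gcongr
      _ = ‖x M‖ ^ 2 + 2 * (48 * l * γ) * ‖x M‖ + 2304 * l ^ 2 * γ ^ 2 := by ring
      _ ≤ ‖x M‖ ^ 2 + 2 * (48 * l * γ) * (10 * α * l * (s + 2 ^ n₀)) + 2304 * l ^ 2 * γ ^ 2 := by
          gcongr
      _ = _ := by ring
  have p1 : 0 ≤ α * γ * s := by positivity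
  have p2 : 0 ≤ l ^ 2 * (α * γ * 2 ^ n₀) := by positivity
  have p3 : 0 ≤ l ^ 2 * γ ^ 2 := by positivity
  have p4 : α * γ * s ≤ l ^ 2 * (α * γ * s) := le_mul_of_one_le_left p1 (by nlinarith)
  nlinarith

end Chaining

/-! ### Admissible nets and the exceptional events -/

section Nets

open Filter Topology

variable {E : Type v} {d : E → E → ℝ} {F : Set E} {T : ℕ → Finset E}

theorem IsAdmissible.nonempty (hT : IsAdmissible d F T) (n : ℕ) : (T n).Nonempty :=
  (Finset.card_pos.1 (by rw [hT.card_zero]; exact one_pos)).mono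
    (monotone_nat_of_le_succ hT.mono (Nat.zero_le n))

theorem IsAdmissible.card_le_exp (hT : IsAdmissible d F T) (n : ℕ) :
    ((T n).card : ℝ≥0∞) ≤ ENNReal.ofReal (Real.exp (4 ^ n)) := by
  have h1 : (T n).card ≤ 2 ^ (4 ^ n) := by
    rcases Nat.eq_zero_or_pos n with rfl | hn
    · simp [hT.card_zero]
    · have := hT.card_le n hn
      rw [pow_mul] at this
      norm_num only at this
      exact this.trans (Nat.sub_le _ _)
  rw [← ENNReal.ofReal_natCast]
  refine ENNReal.ofReal_le_ofReal ?_
  calc ((T n).card : ℝ) ≤ 2 ^ (4 ^ n) := by exact_mod_cast h1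
    _ ≤ Real.exp 1 ^ (4 ^ n) := by
        gcongr; have := Real.add_one_le_exp 1; linarith
    _ = _ := by rw [← Real.exp_nat_mul]; simp

theorem IsAdmissible.exists_nearest (hT : IsAdmissible d F T) (f : E) (n : ℕ) :
    ∃ s ∈ T n, ENNReal.ofReal (d f s) ≤ distTo d f (T n) := by
  obtain ⟨s, hs, hmin⟩ := (T n).exists_min_image (d f) (hT.nonempty n)
  exact ⟨s, hs, le_iInf₂ fun g hg => ENNReal.ofReal_le_ofReal (hmin g hg)⟩

/-- Nearest points along an admissible sequence. -/
theorem IsAdmissible.exists_nearest_seq (hT : IsAdmissible d F T) {S : Set E} (hFS : F ⊆ S)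
    (hd : IsDistOn d S) {γ : ℝ}
    (hγ : 0 ≤ γ) {f : E} (hf : f ∈ F)
    (h : ∑' n : ℕ, 2 ^ n * distTo d f (T n) ≤ ENNReal.ofReal γ) :
    ∃ p : ℕ → E, (∀ n, p n ∈ T n) ∧ (∀ n, ∑ i ∈ Finset.range n, 2 ^ i * d f (p i) ≤ γ) ∧
      ∀ n, d f (p n) ≤ γ / 2 ^ n := by
  choose p hp hpd using hT.exists_nearest f
  have h0 : ∀ n, 0 ≤ d f (p n) := fun n => hd.nonneg f (hFS hf) _ (hFS (hT.subset n (hp n)))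
  have hsum : ∀ n, ∑ i ∈ Finset.range n, 2 ^ i * d f (p i) ≤ γ := fun n => by
    rw [← ENNReal.ofReal_le_ofReal_iff hγ,
      ENNReal.ofReal_sum_of_nonneg fun i _ => mul_nonneg (by positivity) (h0 i)]
    refine (Finset.sum_le_sum fun i _ => ?_).trans
      ((ENNReal.sum_le_tsum (Finset.range n)).trans h)
    rw [ENNReal.ofReal_mul (by positivity), ENNReal.ofReal_pow (by norm_num), ENNReal.ofReal_ofNat]
    gcongr
    exact hpd i
  refine ⟨p, hp, hsum, fun n => ?_⟩
  rw [le_div_iff₀ (by positivity), mul_comm]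
  refine le_trans ?_ (hsum (n + 1))
  exact Finset.single_le_sum (f := fun i => 2 ^ i * d f (p i))
    (fun i _ => mul_nonneg (by positivity) (h0 i)) (Finset.self_mem_range_succ n)

/-- The exponent is split as x + (n + 2), so the terms are dominated by a geometric series. The
factor 1/2 leaves room for a second event of equal probability. -/
theorem sum_range_exp_tail_le {x : ℝ} (hx : 1 ≤ x) :
    ∑' n : ℕ, ENNReal.ofReal (Real.exp (-(9 * x * 4 ^ n))) ≤
      ENNReal.ofReal (Real.exp (-x) / 2) := by
  have hs := hasSum_geometric_two' (Real.exp (-x) / 2)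
  rw [← hs.tsum_eq, ENNReal.ofReal_tsum_of_nonneg (fun n => by positivity) hs.summable]
  refine ENNReal.tsum_le_tsum fun n => ENNReal.ofReal_le_ofReal ?_
  have h4 : (n : ℝ) + 1 ≤ 4 ^ n := by
    have := one_add_mul_le_pow (by norm_num : (-2 : ℝ) ≤ 3) n
    norm_num at this
    have hn : (0:ℝ) ≤ n := n.cast_nonneg
    linarith
  have h2 : Real.exp (-((n : ℝ) + 2)) ≤ 1 / 2 / 2 / 2 ^ n := by
    rw [Real.exp_neg, div_div, div_div, one_div]
    gcongr
    calc (2:ℝ) * (2 * 2 ^ n) = 2 ^ (n + 2) := by ring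
      _ ≤ Real.exp 1 ^ (n + 2) := by
        gcongr; have := Real.add_one_le_exp 1; linarith
      _ = Real.exp (n + 2) := by rw [← Real.exp_nat_mul]; push_cast; ring_nf
  calc Real.exp (-(9 * x * 4 ^ n)) ≤ Real.exp (-x + -((n : ℝ) + 2)) := by
        rw [Real.exp_le_exp]
        have : (n : ℝ) + 1 ≤ x * 4 ^ n := by nlinarith
        have : x ≤ x * 4 ^ n := le_mul_of_one_le_right (by linarith) (one_le_pow₀ (by norm_num))
        nlinarith [n.cast_nonneg (α := ℝ)]
    _ = Real.exp (-x) * Real.exp (-((n : ℝ) + 2)) := Real.exp_add _ _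
    _ ≤ Real.exp (-x) * (1 / 2 / 2 / 2 ^ n) := by gcongr
    _ = _ := by ring

variable {Ω : Type u} [MeasurableSpace Ω] {μ : Measure Ω}

theorem measure_biUnion_finset_le_card_mul {ι : Type*} (I : Finset ι) {s : ι → Set Ω} {p : ℝ≥0∞}
    (hp : ∀ i ∈ I, μ (s i) ≤ p) : μ (⋃ i ∈ I, s i) ≤ I.card * p :=
  (measure_biUnion_finset_le I s).trans
    ((Finset.sum_le_card_nsmul I _ p hp).trans_eq (nsmul_eq_mul _ _))

variable [IsProbabilityMeasure μ]
  {𝒳 : Type v} [MeasurableSpace 𝒳] {N : ℕ} {X : Fin N → Ω → 𝒳} {F : Set (𝒳 → ℝ)}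
  {d : (𝒳 → ℝ) → (𝒳 → ℝ) → ℝ} {T : ℕ → Finset (𝒳 → ℝ)} {α γ l : ℝ} {n₀ : ℕ}

/-- The distances decay geometrically, so 𝔼|f - p n|(X i) is summable in n and the series of
differences converges almost surely. -/
theorem IsSubgaussianFamily.ae_tendsto_of_dist_le (h : IsSubgaussianFamily μ X F d) (hγ : 0 < γ)
    {f : 𝒳 → ℝ} (hf : f ∈ F) {p : ℕ → 𝒳 → ℝ} (hp : ∀ n, p n ∈ F)
    (hd : ∀ n, d f (p n) ≤ γ / 2 ^ n) :
    ∀ᵐ ω ∂μ, ∀ i, Tendsto (fun n => p n (X i ω)) atTop (𝓝 (f (X i ω))) := by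
  rw [ae_all_iff]
  intro i
  have hm : ∀ n, Measurable fun ω => ENNReal.ofReal |f (X i ω) - p n (X i ω)| := fun n =>
    ((h.measurable_comp hf i).sub (h.measurable_comp (hp n) i)).abs.ennreal_ofReal
  have hfin : ∫⁻ ω, ∑' n, ENNReal.ofReal |f (X i ω) - p n (X i ω)| ∂μ ≠ ⊤ := by
    rw [lintegral_tsum fun n => (hm n).aemeasurable]
    refine ne_top_of_le_ne_top ?_ (ENNReal.tsum_le_tsum fun n =>
      h.lintegral_abs_sub_le hf (hp n) (hd n) (by positivity) i)
    rw [← ENNReal.ofReal_tsum_of_nonneg (fun n => by positivity)]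
    · exact ENNReal.ofReal_ne_top
    · exact ((summable_geometric_two' γ).mul_left 8).congr fun n => by ring
  filter_upwards [ae_lt_top' (AEMeasurable.tsum fun n => (hm n).aemeasurable) hfin]
    with ω hω
  have h0 := ENNReal.tendsto_atTop_zero_of_tsum_ne_top hω.ne
  have h1 : Tendsto (fun n => |f (X i ω) - p n (X i ω)|) atTop (𝓝 0) := by
    have := (ENNReal.tendsto_toReal ENNReal.zero_ne_top).comp h0
    simpa [Function.comp_def, ENNReal.toReal_ofReal] using this
  rw [tendsto_iff_dist_tendsto_zero]
  simpa only [Real.dist_eq, abs_sub_comm] using h1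

/-- The exceptional event of the chaining argument at level `n`. -/
def chainBad (μ : Measure Ω) (X : Fin N → Ω → 𝒳) (d : (𝒳 → ℝ) → (𝒳 → ℝ) → ℝ)
    (T : ℕ → Finset (𝒳 → ℝ)) (α γ l : ℝ) (n : ℕ) : Set Ω :=
  (⋃ s ∈ T n, ⋃ t ∈ T (n + 1),
    {ω | 120 * (d t s + γ / 4 ^ n) * α * (Real.sqrt N * (4 * l * 2 ^ n) + (4 * l * 2 ^ n) ^ 2) ≤
      N * empiricalSq μ X t ω - N * empiricalSq μ X s ω} ∪
    {ω | 3 * (d t s + γ / 4 ^ n) ^ 2 * (N + (4 * l * 2 ^ n) ^ 2) ≤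
      ∑ i, (t (X i ω) - s (X i ω)) ^ 2}) ∪
  ⋃ s ∈ T n, {ω | 3 * α ^ 2 * (N + (4 * l * 2 ^ n) ^ 2) ≤ ∑ i, s (X i ω) ^ 2}

/-- Union bound with y = 4^n: there are at most e^{5y} pairs, the three families of events cost a
factor 3 ≤ e^{2y}, and each event has probability at most e^{-16l²y}. Since l ≥ 1, the net exponent
is at most -9l²y. -/
theorem IsSubgaussianFamily.measure_chainBad_le (h : IsSubgaussianFamily μ X F d)
    (hT : IsAdmissible d F T) (hγ : 0 < γ) (hα : 0 < α) (hFα : ∀ f ∈ F, d f 0 ≤ α) (hl : 1 ≤ l)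
    (n : ℕ) :
    μ (chainBad μ X d T α γ l n) ≤ ENNReal.ofReal (Real.exp (-(9 * l ^ 2 * 4 ^ n))) := by
  have h44 : ((2:ℝ) ^ n) ^ 2 = 4 ^ n := by rw [← pow_mul, mul_comm, pow_mul]; norm_num
  have h4 : (1:ℝ) ≤ 4 ^ n := one_le_pow₀ (by norm_num)
  set p := ENNReal.ofReal (Real.exp (-(4 * l * 2 ^ n) ^ 2)) with hp
  set c := ENNReal.ofReal (Real.exp (4 ^ n)) with hc
  set c' := ENNReal.ofReal (Real.exp (4 ^ (n + 1))) with hc'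
  have hq : 0 ≤ 4 * l * 2 ^ n := by positivity
  have key : μ (chainBad μ X d T α γ l n) ≤ c * (c' * (p + p)) + c * p := by
    refine (measure_union_le _ _).trans (add_le_add ?_ ?_)
    · refine (measure_biUnion_finset_le_card_mul (p := c' * (p + p)) _ fun s hs => ?_).trans
        (mul_le_mul_left (hT.card_le_exp n) _)
      refine (measure_biUnion_finset_le_card_mul (p := p + p) _ fun t ht => ?_).trans
        (mul_le_mul_left (hT.card_le_exp (n + 1)) _)
      have hsF := hT.subset n hs
      have htF := hT.subset (n + 1) ht
      have hpos : 0 < γ / 4 ^ n := by positivity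
      have hD : d t s ≤ d t s + γ / 4 ^ n := by linarith
      have hD0 : 0 < d t s + γ / 4 ^ n := by linarith [h.dist_nonneg htF hsF]
      exact (measure_union_le _ _).trans (add_le_add
        (h.measure_empiricalSq_sub_ge htF hsF hD hD0 (hFα t htF) (hFα s hsF) hα hq)
        (h.measure_sum_sub_sq_ge htF hsF hD hD0 _))
    · refine (measure_biUnion_finset_le_card_mul (p := p) _ fun s hs => ?_).trans
        (mul_le_mul_left (hT.card_le_exp n) _)
      have hsF := hT.subset n hs
      exact h.measure_sum_sq_ge hsF (hFα s hsF) hα _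
  refine key.trans ?_
  rw [hp, hc, hc', ← ENNReal.ofReal_add (by positivity) (by positivity),
    ← ENNReal.ofReal_mul (by positivity), ← ENNReal.ofReal_mul (by positivity),
    ← ENNReal.ofReal_mul (by positivity), ← ENNReal.ofReal_add (by positivity) (by positivity)]
  refine ENNReal.ofReal_le_ofReal ?_
  have e1 : (4 * l * 2 ^ n) ^ 2 = 16 * l ^ 2 * 4 ^ n := by rw [mul_pow, mul_pow, h44]; ring
  set P := Real.exp (-(4 * l * 2 ^ n) ^ 2) with hP
  set y : ℝ := 4 ^ n with hy
  have e2 : (4:ℝ) ^ (n + 1) = 4 * y := by rw [pow_succ]; ring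
  have hc1 : 1 ≤ Real.exp (4 * y) := Real.one_le_exp (by linarith)
  have h3 : 3 ≤ Real.exp (2 * y) := by have := Real.add_one_le_exp (2 * y); linarith
  rw [e2]
  have hyl : y ≤ l ^ 2 * y := le_mul_of_one_le_left (by linarith) (by nlinarith)
  calc Real.exp y * (Real.exp (4 * y) * (P + P)) + Real.exp y * P
      ≤ Real.exp y * (Real.exp (4 * y) * (P + P)) + Real.exp y * (Real.exp (4 * y) * P) := by
        gcongr
        exact le_mul_of_one_le_left (Real.exp_pos _).le hc1
    _ = 3 * (Real.exp y * Real.exp (4 * y) * P) := by ring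
    _ ≤ Real.exp (2 * y) * (Real.exp y * Real.exp (4 * y) * P) := by gcongr
    _ ≤ _ := by
        rw [hP, e1, ← Real.exp_add, ← Real.exp_add, ← Real.exp_add, Real.exp_le_exp]
        linarith

theorem IsSubgaussianFamily.chain_le_of_notMem_chainBad (h : IsSubgaussianFamily μ X F d)
    (hT : IsAdmissible d F T) (hγ : 0 < γ) (hα : 0 < α) (hFα : ∀ f ∈ F, d f 0 ≤ α) (hl : 1 ≤ l)
    {f : 𝒳 → ℝ} (hf : f ∈ F) {p : ℕ → 𝒳 → ℝ} (hp : ∀ n, p n ∈ T n)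
    (hsum : ∀ n, ∑ i ∈ Finset.range n, 2 ^ i * d f (p i) ≤ γ) (hd : ∀ n, d f (p n) ≤ γ / 2 ^ n)
    {ω : Ω} (hlim : ∀ i, Tendsto (fun n => p n (X i ω)) atTop (𝓝 (f (X i ω))))
    (hω : ∀ n ≥ n₀, ω ∉ chainBad μ X d T α γ l n) :
    N * empiricalSq μ X f ω - N * empiricalSq μ X (p n₀) ω ≤
      11000 * l ^ 2 * (γ ^ 2 + α * γ * Real.sqrt N + α * γ * 2 ^ n₀) := by
  have hpF : ∀ n, p n ∈ F := fun n => hT.subset n (hp n)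
  have hss : Real.sqrt N ^ 2 = N := Real.sq_sqrt (by positivity)
  set V : (𝒳 → ℝ) → EuclideanSpace ℝ (Fin N) := fun g => WithLp.toLp 2 fun i => g (X i ω) with hV
  set e : (𝒳 → ℝ) → ℝ := fun g => ∑ i, ∫ ω', g (X i ω') ^ 2 ∂μ with he
  have hVe : ∀ g, N * empiricalSq μ X g ω = ‖V g‖ ^ 2 - e g := fun g => by
    rw [h.mul_empiricalSq, EuclideanSpace.real_norm_sq_eq, Finset.sum_sub_distrib]
  -- The padding γ/4^n keeps the scale positive when two net points are at distance 0, and adds only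
  -- 2γ to ∑ 2^n δ n.
  set δ : ℕ → ℝ := fun n => d (p (n + 1)) (p n) + γ / 4 ^ n with hδ
  have hpd0 : ∀ n, 0 ≤ d f (p n) := fun n => h.dist_nonneg hf (hpF n)
  have hδle : ∀ n, δ n ≤ d f (p n) + d f (p (n + 1)) + γ / 4 ^ n := fun n => by
    have h1 := h.dist.triangle _ (.inr (hpF (n + 1))) f (.inr hf) _ (.inr (hpF n))
    rw [h.dist.symm _ (.inr (hpF (n + 1))) f (.inr hf)] at h1
    simp only [hδ]; linarith
  have hgeo : ∀ n, ∑ i ∈ Finset.range n, (2:ℝ) ^ i * (γ / 4 ^ i) ≤ 2 * γ := fun n => by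
    have h1 : ∀ i : ℕ, (2:ℝ) ^ i * (γ / 4 ^ i) = γ * (1 / 2) ^ i := fun i => by
      rw [show (4:ℝ) = 2 * 2 by norm_num, mul_pow, div_pow, one_pow]; field_simp
    simp only [h1]
    rw [← Finset.mul_sum, mul_comm]
    gcongr
    exact sum_geometric_two_le n
  have hδ0 : ∀ n, 0 ≤ δ n := fun n =>
    add_nonneg (h.dist_nonneg (hpF _) (hpF _)) (by positivity)
  rw [hVe, hVe]
  refine chain_bound (x := fun n => V (p n)) (δ := δ) (e := fun n => e (p n)) ?_ h.one_le hl
    hα.le hγ.le hδ0 (fun n => ?_) (fun n hn => ?_) (fun n hn => ?_) (fun n hn => ?_) fun n => ?_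
  · exact ((PiLp.continuous_toLp 2 _).tendsto _).comp (tendsto_pi_nhds.2 hlim)
  · have h2 : ∑ i ∈ Finset.range n, (2:ℝ) ^ i * d f (p (i + 1)) ≤ γ := by
      refine le_trans ?_ (hsum (n + 1))
      rw [Finset.sum_range_succ']
      have : 0 ≤ 2 ^ 0 * d f (p 0) := by simpa using hpd0 0
      refine le_trans (Finset.sum_le_sum fun i _ => ?_) (le_add_of_nonneg_right this)
      gcongr
      · exact hpd0 _
      · norm_num
      · omega
    calc ∑ i ∈ Finset.range n, 2 ^ i * δ i
        ≤ ∑ i ∈ Finset.range n, (2 ^ i * d f (p i) + 2 ^ i * d f (p (i + 1)) +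
            2 ^ i * (γ / 4 ^ i)) := Finset.sum_le_sum fun i _ => by
          rw [← mul_add, ← mul_add]; gcongr; exact hδle i
      _ ≤ 4 * γ := by
          rw [Finset.sum_add_distrib, Finset.sum_add_distrib]
          linarith [hsum n, hgeo n]
  · have h1 := hω n hn
    simp only [chainBad, Set.mem_union, Set.mem_iUnion, not_or, not_exists] at h1
    have h2 := (h1.1 (p n) (hp n) (p (n + 1)) (hp (n + 1))).1
    simp only [Set.mem_ofPred_eq, not_le, hVe] at h2
    exact h2.le
  · have h1 := hω n hn
    simp only [chainBad, Set.mem_union, Set.mem_iUnion, not_or, not_exists] at h1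
    have h2 := (h1.1 (p n) (hp n) (p (n + 1)) (hp (n + 1))).2
    simp only [Set.mem_ofPred_eq, not_le] at h2
    have hδn := hδ0 n
    refine (sq_le_sq₀ (norm_nonneg _) (by positivity)).1 ?_
    rw [EuclideanSpace.real_norm_sq_eq]
    refine h2.le.trans ?_
    rw [← hss]
    have : 0 ≤ Real.sqrt N * (4 * l * 2 ^ n) := by positivity
    -- Makes the squared bound a perfect square, so that its root is linear in √N and 2^n.
    have h3 : 3 * (Real.sqrt N ^ 2 + (4 * l * 2 ^ n) ^ 2) ≤ 4 * (Real.sqrt N + 4 * l * 2 ^ n) ^ 2 := by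
      nlinarith
    calc _ = δ n ^ 2 * (3 * (Real.sqrt N ^ 2 + (4 * l * 2 ^ n) ^ 2)) := by
          simp only [hδ, hss]; ring
      _ ≤ δ n ^ 2 * (4 * (Real.sqrt N + 4 * l * 2 ^ n) ^ 2) := by gcongr
      _ = _ := by rw [hss]; ring
  · have h1 := hω n hn
    simp only [chainBad, Set.mem_union, Set.mem_iUnion, not_or, not_exists] at h1
    have h2 := h1.2 (p n) (hp n)
    simp only [Set.mem_ofPred_eq, not_le] at h2
    refine (sq_le_sq₀ (norm_nonneg _) (by positivity)).1 ?_
    rw [EuclideanSpace.real_norm_sq_eq]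
    refine h2.le.trans ?_
    have : 0 ≤ Real.sqrt N * (4 * l * 2 ^ n) := by positivity
    have h3 : 3 * (N + (4 * l * 2 ^ n) ^ 2) ≤ 4 * (Real.sqrt N + 4 * l * 2 ^ n) ^ 2 := by
      nlinarith
    calc _ = α ^ 2 * (3 * (N + (4 * l * 2 ^ n) ^ 2)) := by ring
      _ ≤ α ^ 2 * (4 * (Real.sqrt N + 4 * l * 2 ^ n) ^ 2) := by gcongr
      _ = _ := by ring
  · have h1 := h.abs_sum_integral_sq_sub_le hf (hpF n) (hd n) (by positivity) (hFα f hf)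
      (hFα _ (hpF n)) hα
    have h2 : e (p n) - e f ≤ 24 * N * (γ / 2 ^ n) * α := by
      have := neg_le_of_abs_le h1
      simp only [he]; linarith
    calc (e (p n) - e f) * 2 ^ n ≤ 24 * N * (γ / 2 ^ n) * α * 2 ^ n := by gcongr
      _ = _ := by field_simp

/-- Chaining from level `n₀`: off an event of small probability, every member of a countable
subfamily is controlled by some point of the net `T n₀`. -/
theorem IsSubgaussianFamily.measure_chain_le (h : IsSubgaussianFamily μ X F d)
    (hT : IsAdmissible d F T) (hγ : 0 < γ) (hα : 0 < α) (hFα : ∀ f ∈ F, d f 0 ≤ α)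
    (hTγ : ∀ f ∈ F, ∑' n : ℕ, 2 ^ n * distTo d f (T n) ≤ ENNReal.ofReal γ)
    {F₀ : Set (𝒳 → ℝ)} (hF₀ : F₀ ⊆ F) (hc : F₀.Countable) (hl : 1 ≤ l) (n₀ : ℕ) :
    μ {ω | ¬ ∀ f ∈ F₀, ∃ s ∈ T n₀, N * empiricalSq μ X f ω - N * empiricalSq μ X s ω ≤
      11000 * l ^ 2 * (γ ^ 2 + α * γ * Real.sqrt N + α * γ * 2 ^ n₀)} ≤
      ENNReal.ofReal (Real.exp (-(l ^ 2 * 4 ^ n₀)) / 2) := by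
  choose! p hp hsum hd using fun f (hf : f ∈ F) =>
    hT.exists_nearest_seq (Set.subset_insert 0 F) h.dist hγ.le hf (hTγ f hf)
  have hae : ∀ᵐ ω ∂μ, ∀ f ∈ F₀, ∀ i, Tendsto (fun n => p f n (X i ω)) atTop (𝓝 (f (X i ω))) :=
    (ae_ball_iff hc).2 fun f hf => h.ae_tendsto_of_dist_le hγ (hF₀ hf)
      (fun n => hT.subset n (hp f (hF₀ hf) n)) (hd f (hF₀ hf))
  calc μ _ ≤ μ (⋃ n, chainBad μ X d T α γ l (n₀ + n)) := by
        refine measure_mono_ae ?_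
        filter_upwards [hae] with ω hω hbad
        by_contra hcon
        refine hbad fun f hf => ⟨p f n₀, hp f (hF₀ hf) n₀, ?_⟩
        refine h.chain_le_of_notMem_chainBad hT hγ hα hFα hl (hF₀ hf) (hp f (hF₀ hf))
          (hsum f (hF₀ hf)) (hd f (hF₀ hf)) (hω f hf) fun n hn hm => hcon ?_
        refine Set.mem_iUnion.2 ⟨n - n₀, ?_⟩
        rwa [Nat.add_sub_cancel' hn]
    _ ≤ ∑' n, ENNReal.ofReal (Real.exp (-(9 * (l ^ 2 * 4 ^ n₀) * 4 ^ n))) := by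
        refine (measure_iUnion_le _).trans (ENNReal.tsum_le_tsum fun n => ?_)
        refine (h.measure_chainBad_le hT hγ hα hFα hl (n₀ + n)).trans_eq ?_
        rw [pow_add]; ring_nf
    _ ≤ _ := sum_range_exp_tail_le (by
        have : (1:ℝ) ≤ 4 ^ n₀ := one_le_pow₀ (by norm_num)
        nlinarith)

end Nets

/-! ### Moments from tails, and one-sided Chebyshev -/

section Moments

open Filter Topology

variable {Ω : Type u} [MeasurableSpace Ω] {μ : Measure Ω}

theorem measure_gt_le_of_forall_gt {W : Ω → ℝ} {c : ℝ} {p : ℝ≥0∞}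
    (h : ∀ c' > c, μ {ω | c' < W ω} ≤ p) : μ {ω | c < W ω} ≤ p := by
  have h1 : {ω | c < W ω} = ⋃ n : ℕ, {ω | c + 1 / ((n : ℝ) + 1) < W ω} := by
    ext ω
    simp only [Set.mem_ofPred_eq, Set.mem_iUnion]
    refine ⟨fun hω => ?_, fun ⟨n, hn⟩ => ?_⟩
    · obtain ⟨n, hn⟩ := exists_nat_one_div_lt (sub_pos.2 hω)
      exact ⟨n, by linarith⟩
    · have : 0 < 1 / ((n : ℝ) + 1) := by positivity
      linarith
  have hmono : Monotone fun n : ℕ => {ω | c + 1 / ((n : ℝ) + 1) < W ω} := fun m n hmn ω hω => by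
    simp only [Set.mem_ofPred_eq] at hω ⊢
    refine lt_of_le_of_lt ?_ hω
    gcongr
  rw [h1, hmono.measure_iUnion]
  refine iSup_le fun n => h _ ?_
  have : 0 < 1 / ((n : ℝ) + 1) := by positivity
  show c < _
  linarith

variable [IsProbabilityMeasure μ]

/-- A dyadic layer-cake bound: if 4^k < R ≤ 4^(k+1), monotonicity gives H(R) ≤ H(4^(k+1)). -/
theorem lintegral_le_of_measure_gt_le {R : Ω → ℝ} (hR : Measurable R)
    (h : ∀ k : ℕ, μ {ω | 4 ^ k < R ω} ≤ ENNReal.ofReal (Real.exp (-4 ^ k))) {H : ℝ → ℝ≥0∞}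
    (hH : Monotone H) :
    ∫⁻ ω, H (R ω) ∂μ ≤ H 1 + ∑' k : ℕ, H (4 ^ (k + 1)) * ENNReal.ofReal (Real.exp (-4 ^ k)) := by
  have hm : ∀ k : ℕ, MeasurableSet {ω | (4:ℝ) ^ k < R ω} := fun k =>
    measurableSet_lt measurable_const hR
  calc ∫⁻ ω, H (R ω) ∂μ
      ≤ ∫⁻ ω, (H 1 + ∑' k : ℕ, {ω | (4:ℝ) ^ k < R ω}.indicator (fun _ => H (4 ^ (k + 1))) ω) ∂μ := by
        refine lintegral_mono fun ω => ?_
        rcases le_or_gt (R ω) 1 with h1 | h1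
        · exact (hH h1).trans le_self_add
        · obtain ⟨k, hk1, hk2⟩ := exists_nat_pow_near h1.le (by norm_num : (1:ℝ) < 4)
          rcases hk1.lt_or_eq with hlt | heq
          · refine le_trans ?_ le_add_self
            refine le_trans ?_ (ENNReal.le_tsum k)
            rw [Set.indicator_of_mem (by exact hlt)]
            exact hH hk2.le
          · refine le_trans ?_ le_add_self
            -- At R = 4^k the strict event of index k fails, so the one of index k - 1 is used.
            cases k with
            | zero => simp at heq; linarith
            | succ k =>
              refine le_trans ?_ (ENNReal.le_tsum k)
              rw [Set.indicator_of_mem]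
              · rw [heq]
              · rw [Set.mem_ofPred_eq, ← heq]
                exact pow_lt_pow_right₀ (by norm_num) (Nat.lt_succ_self k)
    _ = H 1 + ∑' k : ℕ, H (4 ^ (k + 1)) * μ {ω | (4:ℝ) ^ k < R ω} := by
        rw [lintegral_add_left measurable_const, lintegral_tsum fun k =>
          (measurable_const.indicator (hm k)).aemeasurable]
        simp only [lintegral_indicator (hm _), lintegral_const, measure_univ, mul_one,
          Measure.restrict_apply MeasurableSet.univ, Set.univ_inter]
    _ ≤ _ := by gcongr with k; exact h k

theorem integral_sq_le_of_measure_gt_le {D : Ω → ℝ} (hD : Measurable D) (hD0 : 0 ≤ᵐ[μ] D) {b : ℝ}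
    (hb : 0 < b) (h : ∀ k : ℕ, μ {ω | b * 4 ^ k < D ω} ≤ ENNReal.ofReal (Real.exp (-4 ^ k))) :
    MemLp D 2 μ ∧ ∫ ω, D ω ^ 2 ∂μ ≤ 129 * b ^ 2 ∧ ∫ ω, D ω ∂μ ≤ 12 * b := by
  have h1 := lintegral_le_of_measure_gt_le (μ := μ) (R := fun ω => D ω / b) (hD.div_const b)
    (fun k => by simpa only [lt_div_iff₀' hb] using h k)
    (H := fun x => ENNReal.ofReal ((max x 0) ^ 2)) fun x y hxy => by
      simp only
      gcongr
  have h2 : ∑' k : ℕ, ENNReal.ofReal ((max ((4:ℝ) ^ (k + 1)) 0) ^ 2) *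
      ENNReal.ofReal (Real.exp (-4 ^ k)) ≤ ENNReal.ofReal 128 := by
    have hs : HasSum (fun k : ℕ => (96:ℝ) * (1 / 4) ^ k) 128 := by
      have := (hasSum_geometric_of_lt_one (r := (1 / 4 : ℝ)) (by norm_num) (by norm_num)).mul_left 96
      norm_num at this ⊢
      exact this
    rw [← hs.tsum_eq, ENNReal.ofReal_tsum_of_nonneg (fun n => by positivity) hs.summable]
    refine ENNReal.tsum_le_tsum fun k => ?_
    rw [← ENNReal.ofReal_mul (by positivity)]
    refine ENNReal.ofReal_le_ofReal ?_
    rw [max_eq_left (by positivity), Real.exp_neg, ← div_eq_mul_inv, div_le_iff₀ (Real.exp_pos _)]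
    set y : ℝ := 4 ^ k with hy
    have hy0 : 0 < y := by positivity
    -- From y³/6 ≤ e^y, each term 16y²e^{-y} is at most 96/y, with y = 4^k; these sum to 128.
    have h3 := Real.pow_div_factorial_le_exp y hy0.le 3
    have h6 : ((3 : ℕ).factorial : ℝ) = 6 := by norm_num [Nat.factorial]
    rw [h6] at h3
    have e1 : ((4:ℝ) ^ (k + 1)) ^ 2 = 16 * y ^ 2 := by rw [pow_succ 4 k, mul_pow]; ring
    have e2 : (1 / 4 : ℝ) ^ k = 1 / y := by rw [hy, div_pow, one_pow]
    rw [e1, e2]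
    calc 16 * y ^ 2 = 96 * (1 / y) * (y ^ 3 / 6) := by field_simp; norm_num
      _ ≤ _ := by gcongr
  have h3 : ∫⁻ ω, ENNReal.ofReal ((D ω / b) ^ 2) ∂μ ≤ ENNReal.ofReal 129 := by
    calc _ = ∫⁻ ω, ENNReal.ofReal ((max (D ω / b) 0) ^ 2) ∂μ := by
          refine lintegral_congr_ae ?_
          filter_upwards [hD0] with ω hω
          rw [max_eq_left (div_nonneg hω hb.le)]
      _ ≤ _ := h1.trans (add_le_add le_rfl h2)
      _ = _ := by
        rw [← ENNReal.ofReal_add (by positivity) (by norm_num)]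
        norm_num
  have hm : Measurable fun ω => (D ω / b) ^ 2 := (hD.div_const b).pow_const 2
  have hi : Integrable (fun ω => (D ω / b) ^ 2) μ :=
    (lintegral_ofReal_ne_top_iff_integrable hm.aestronglyMeasurable
      (ae_of_all _ fun ω => sq_nonneg _)).1 (ne_top_of_le_ne_top ENNReal.ofReal_ne_top h3)
  have h4 : ∫ ω, (D ω / b) ^ 2 ∂μ ≤ 129 := by
    rwa [← ENNReal.ofReal_le_ofReal_iff (by norm_num), ofReal_integral_eq_lintegral_ofReal hi
      (ae_of_all _ fun ω => sq_nonneg _)]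
  have e : ∀ ω, D ω ^ 2 = b ^ 2 * (D ω / b) ^ 2 := fun ω => by field_simp
  have hi2 : Integrable (fun ω => D ω ^ 2) μ := by
    simp only [e]; exact hi.const_mul _
  have hL : MemLp D 2 μ := (memLp_two_iff_integrable_sq hD.aestronglyMeasurable).2 hi2
  have h5 : ∫ ω, D ω ^ 2 ∂μ ≤ 129 * b ^ 2 := by
    simp only [e]
    rw [integral_const_mul, mul_comm]
    gcongr
  refine ⟨hL, h5, ?_⟩
  have h6 := variance_nonneg D μ
  rw [variance_eq_sub hL] at h6
  -- Nonnegativity of the variance, together with 129 ≤ 144.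
  have h7 : (∫ ω, D ω ∂μ) ^ 2 ≤ (12 * b) ^ 2 := by
    have : ∫ ω, (D ^ 2) ω ∂μ = ∫ ω, D ω ^ 2 ∂μ := rfl
    nlinarith
  exact (abs_le_of_sq_le_sq' h7 (by positivity)).2

/-- One-sided Chebyshev inequality, for a variable with nonpositive mean. -/
theorem measure_ge_le_exp_neg_sq {V : Ω → ℝ} (hV : MemLp V 2 μ) (hmean : ∫ ω, V ω ∂μ ≤ 0) {s u : ℝ}
    (hs : 0 < s) (hsq : ∫ ω, V ω ^ 2 ∂μ ≤ s ^ 2) (hu0 : 0 < u) (hu : u ≤ 1) :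
    μ {ω | 2 * u * s ≤ V ω} ≤ ENNReal.ofReal (Real.exp (-u ^ 2)) := by
  -- The optimal shift in Cantelli's inequality for the threshold 2us. It gives 1/(1 + 4u²), and
  -- e^{u²} ≤ 1 + u² + 3u⁴ ≤ 1 + 4u² for u ≤ 1.
  set y := s / (2 * u) with hy
  have hy0 : 0 < y := by positivity
  have hi : Integrable (fun ω => (V ω + y) ^ 2) μ := (hV.add (memLp_const y)).integrable_sq
  have h1 : ∫ ω, (V ω + y) ^ 2 ∂μ ≤ s ^ 2 + y ^ 2 := by
    have e : ∀ ω, (V ω + y) ^ 2 = V ω ^ 2 + (2 * y * V ω + y ^ 2) := fun ω => by ring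
    have hVi : Integrable V μ := hV.integrable one_le_two
    have hi' : Integrable (fun ω => 2 * y * V ω + y ^ 2) μ :=
      (hVi.const_mul _).add (integrable_const _)
    simp only [e]
    rw [integral_add hV.integrable_sq hi', integral_add (hVi.const_mul _) (integrable_const _),
      integral_const_mul]
    simp
    nlinarith
  have h2 := mul_meas_ge_le_integral_of_nonneg (ae_of_all μ fun ω => sq_nonneg (V ω + y)) hi
    ((2 * u * s + y) ^ 2)
  have hsub : {ω | 2 * u * s ≤ V ω} ⊆ {ω | (2 * u * s + y) ^ 2 ≤ (V ω + y) ^ 2} := fun ω hω => by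
    simp only [Set.mem_ofPred_eq] at hω ⊢
    gcongr
  have h3 : μ.real {ω | 2 * u * s ≤ V ω} ≤ 1 / (1 + 4 * u ^ 2) := by
    refine (measureReal_mono hsub).trans ?_
    have hpos : 0 < (2 * u * s + y) ^ 2 := by positivity
    rw [← mul_le_mul_iff_right₀ hpos]
    refine (h2.trans h1).trans (le_of_eq ?_)
    rw [hy]
    field_simp
    ring
  rw [ENNReal.le_ofReal_iff_toReal_le (measure_ne_top _ _) (Real.exp_pos _).le]
  refine h3.trans ?_
  rw [Real.exp_neg, one_div]
  gcongr
  have hu2 : u ^ 2 ≤ 1 := by nlinarith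
  have h4 := exp_le_one_add_add_sq_mul_exp_abs (u ^ 2)
  have h5 : Real.exp |u ^ 2| ≤ 3 := by
    rw [abs_of_nonneg (sq_nonneg _)]
    have := Real.exp_one_lt_d9
    exact (Real.exp_le_exp.2 hu2).trans (by linarith)
  have h6 : (u ^ 2) ^ 2 * Real.exp |u ^ 2| ≤ u ^ 2 * 3 := by
    gcongr
    nlinarith [sq_nonneg u]
  linarith

end Moments

/-! ### Tails of the supremum -/

section Supremum

open Filter Topology

variable {Ω : Type u} [MeasurableSpace Ω] {μ : Measure Ω} [IsProbabilityMeasure μ]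
  {𝒳 : Type v} [MeasurableSpace 𝒳] {N : ℕ} {X : Fin N → Ω → 𝒳} {F F₀ : Set (𝒳 → ℝ)}
  {d : (𝒳 → ℝ) → (𝒳 → ℝ) → ℝ} {T : ℕ → Finset (𝒳 → ℝ)} {α γ : ℝ}

/-- The tail of the supremum, by chaining from the net of level `k`. -/
theorem IsSubgaussianFamily.measure_exists_gt_le (h : IsSubgaussianFamily μ X F d)
    (hT : IsAdmissible d F T) (hγ : 0 < γ) (hα : 0 < α) (hFα : ∀ f ∈ F, d f 0 ≤ α)
    (hTγ : ∀ f ∈ F, ∑' n : ℕ, 2 ^ n * distTo d f (T n) ≤ ENNReal.ofReal γ)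
    (hF₀ : F₀ ⊆ F) (hc : F₀.Countable) (k : ℕ) :
    μ {ω | ¬ ∀ f ∈ F₀, empiricalSq μ X f ω ≤ 17000 * (γ ^ 2 / N + α * γ / Real.sqrt N) +
      17000 * (α ^ 2 / Real.sqrt N) * (2 ^ k + 4 ^ k / Real.sqrt N)} ≤
      ENNReal.ofReal (Real.exp (-4 ^ k)) := by
  have hN : (0:ℝ) < N := by exact_mod_cast h.one_le
  have hs : 0 < Real.sqrt N := Real.sqrt_pos.2 hN
  have hss : Real.sqrt N ^ 2 = N := Real.sq_sqrt hN.le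
  have h44 : ((2:ℝ) ^ k) ^ 2 = 4 ^ k := by rw [← pow_mul, mul_comm, pow_mul]; norm_num
  have h4 : (1:ℝ) ≤ 4 ^ k := one_le_pow₀ (by norm_num)
  -- The deviation is encoded in the starting level k, with l = 1, so the γ-terms keep a fixed
  -- constant.
  have h1 := h.measure_chain_le hT hγ hα hFα hTγ hF₀ hc le_rfl k
  have h2 : μ (⋃ s ∈ T k, {ω | 30 * α ^ 2 * (Real.sqrt N * (4 * 2 ^ k) + (4 * 2 ^ k) ^ 2) ≤
      N * empiricalSq μ X s ω}) ≤ ENNReal.ofReal (Real.exp (-4 ^ k) / 2) := by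
    refine ((measure_biUnion_finset_le_card_mul _ fun s hs' =>
      h.measure_empiricalSq_ge (hT.subset k hs') (hFα s (hT.subset k hs')) hα
        (by positivity)).trans (mul_le_mul_left (hT.card_le_exp k) _)).trans ?_
    rw [← ENNReal.ofReal_mul (by positivity)]
    refine ENNReal.ofReal_le_ofReal ?_
    have h3 : 2 ≤ Real.exp 1 := by have := Real.add_one_le_exp 1; linarith
    rw [le_div_iff₀ two_pos]
    calc _ ≤ Real.exp (4 ^ k) * Real.exp (-(4 * 2 ^ k) ^ 2) * Real.exp 1 := by gcongr
      _ ≤ _ := by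
        rw [← Real.exp_add, ← Real.exp_add, Real.exp_le_exp, mul_pow, h44]
        linarith
  refine (measure_mono (t := _ ∪ _) ?_).trans ((measure_union_le _ _).trans
    ((add_le_add h1 h2).trans_eq ?_))
  · intro ω hω
    by_contra hcon
    simp only [Set.mem_union, not_or, Set.mem_ofPred_eq, not_not, Set.mem_iUnion, not_exists,
      not_le] at hcon
    refine hω fun f hf => ?_
    obtain ⟨s, hsT, hfs⟩ := hcon.1 f hf
    have h3 := hcon.2 s hsT
    have h5 : N * empiricalSq μ X f ω ≤ 17000 * (γ ^ 2 + α * γ * Real.sqrt N) +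
        17000 * α ^ 2 * (Real.sqrt N * 2 ^ k + 4 ^ k) := by
      -- The cross term left by starting at level k is split between the γ² term and the deviation
      -- term.
      have e1 : α * γ * 2 ^ k ≤ (γ ^ 2 + α ^ 2 * 4 ^ k) / 2 := by
        rw [← h44]; nlinarith [sq_nonneg (γ - α * 2 ^ k)]
      have e2 : (4 * (2:ℝ) ^ k) ^ 2 = 16 * 4 ^ k := by rw [mul_pow, h44]; norm_num
      rw [e2] at h3
      have p1 : 0 ≤ α * γ * Real.sqrt N := by positivity
      have p2 : 0 ≤ α ^ 2 * (Real.sqrt N * 2 ^ k) := by positivity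
      have p3 : 0 ≤ α ^ 2 * 4 ^ k := by positivity
      nlinarith
    refine le_of_mul_le_mul_left (h5.trans_eq ?_) hN
    rw [← hss, Real.sqrt_sq hs.le]
    field_simp
  · rw [← ENNReal.ofReal_add (by positivity) (by positivity)]
    congr 1
    ring_nf

/-- Chaining from the root of the net. -/
theorem IsSubgaussianFamily.exists_measure_sub_gt_le (h : IsSubgaussianFamily μ X F d)
    (hT : IsAdmissible d F T) (hγ : 0 < γ) (hα : 0 < α) (hFα : ∀ f ∈ F, d f 0 ≤ α)
    (hTγ : ∀ f ∈ F, ∑' n : ℕ, 2 ^ n * distTo d f (T n) ≤ ENNReal.ofReal γ)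
    (hF₀ : F₀ ⊆ F) (hc : F₀.Countable) :
    ∃ g ∈ F, ∀ k : ℕ, μ {ω | ¬ ∀ f ∈ F₀, empiricalSq μ X f ω ≤ empiricalSq μ X g ω +
      22000 * (γ ^ 2 / N + α * γ / Real.sqrt N) * 4 ^ k} ≤ ENNReal.ofReal (Real.exp (-4 ^ k)) := by
  have hN : (0:ℝ) < N := by exact_mod_cast h.one_le
  have hs : 1 ≤ Real.sqrt N := Real.one_le_sqrt.2 (by exact_mod_cast h.one_le)
  have hss : Real.sqrt N ^ 2 = N := Real.sq_sqrt hN.le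
  obtain ⟨g, hg⟩ := Finset.card_eq_one.1 hT.card_zero
  refine ⟨g, hT.subset 0 (by simp [hg]), fun k => ?_⟩
  have h44 : ((2:ℝ) ^ k) ^ 2 = 4 ^ k := by rw [← pow_mul, mul_comm, pow_mul]; norm_num
  -- Here the level stays 0 and l = 2^k carries the deviation: the bound grows like l² = 4^k, but
  -- involves no α² term.
  have h1 := h.measure_chain_le hT hγ hα hFα hTγ hF₀ hc (l := 2 ^ k)
    (one_le_pow₀ (by norm_num)) 0
  refine (measure_mono ?_).trans (h1.trans (ENNReal.ofReal_le_ofReal ?_))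
  · intro ω hω
    simp only [Set.mem_ofPred_eq] at hω ⊢
    refine fun hcon => hω fun f hf => ?_
    obtain ⟨s, hsT, hfs⟩ := hcon f hf
    rw [hg, Finset.mem_singleton] at hsT
    subst hsT
    rw [h44, pow_zero, mul_one] at hfs
    have p1 : 0 ≤ α * γ * (Real.sqrt N - 1) := mul_nonneg (by positivity) (by linarith)
    have p2 : 0 ≤ γ ^ 2 := by positivity
    have h5 : N * empiricalSq μ X f ω ≤ N * empiricalSq μ X s ω +
        22000 * (γ ^ 2 + α * γ * Real.sqrt N) * 4 ^ k := by
      have : 11000 * (4:ℝ) ^ k * (γ ^ 2 + α * γ * Real.sqrt N + α * γ) ≤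
          11000 * (4:ℝ) ^ k * (2 * (γ ^ 2 + α * γ * Real.sqrt N)) := by
        gcongr; linarith
      linarith
    refine le_of_mul_le_mul_left (h5.trans_eq ?_) hN
    have hs0 : Real.sqrt N ≠ 0 := by positivity
    rw [mul_add (N : ℝ), add_right_inj]
    rw [← hss, Real.sqrt_sq (by positivity)]
    field_simp
  · rw [h44, pow_zero, mul_one]
    have := Real.exp_pos (-4 ^ k)
    linarith

/-- A real-valued measurable version `W` of the supremum of the process. -/
theorem IsSubgaussianFamily.exists_measurable_sup (h : IsSubgaussianFamily μ X F d)
    (hF : F.Nonempty) (hF₀ : F₀ ⊆ F) (hc : F₀.Countable)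
    (hsep : ∀ᵐ ω ∂μ, ∀ f ∈ F, ∀ ε : ℝ, 0 < ε →
      ∃ g ∈ F₀, d f g < ε ∧ |empiricalSq μ X f ω - empiricalSq μ X g ω| < ε)
    (hbdd : ∀ᵐ ω ∂μ, ∃ c, ∀ f ∈ F₀, empiricalSq μ X f ω ≤ c) :
    ∃ W : Ω → ℝ, Measurable W ∧ (∀ᵐ ω ∂μ, supEmpiricalSq μ X F ω = (W ω : EReal)) ∧
      (∀ᵐ ω ∂μ, ∀ f ∈ F, empiricalSq μ X f ω ≤ W ω) ∧
      ∀ᵐ ω ∂μ, ∀ c, (∀ f ∈ F₀, empiricalSq μ X f ω ≤ c) → W ω ≤ c := by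
  have hne : F₀.Nonempty := by
    obtain ⟨ω, hω⟩ := hsep.exists
    obtain ⟨f, hf⟩ := hF
    obtain ⟨g, hg, -⟩ := hω f hf 1 one_pos
    exact ⟨g, hg⟩
  have := hc.to_subtype
  have := hne.to_subtype
  -- The real supremum is 0 by default where the family is unbounded; `hbdd` confines this to a null
  -- set.
  set W : Ω → ℝ := fun ω => ⨆ f : F₀, empiricalSq μ X f ω with hW
  have hle : ∀ᵐ ω ∂μ, ∀ f ∈ F, empiricalSq μ X f ω ≤ W ω := by
    filter_upwards [hsep, hbdd] with ω hω ⟨c, hc⟩ f hf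
    refine le_of_forall_pos_le_add fun ε hε => ?_
    obtain ⟨g, hg, -, hfg⟩ := hω f hf ε hε
    have h1 : empiricalSq μ X g ω ≤ W ω :=
      le_ciSup (f := fun f : F₀ => empiricalSq μ X f ω) ⟨c, by rintro _ ⟨f, rfl⟩; exact hc f f.2⟩
        ⟨g, hg⟩
    have := (abs_lt.1 hfg).2
    linarith
  have hlub : ∀ ω c, (∀ f ∈ F₀, empiricalSq μ X f ω ≤ c) → W ω ≤ c := fun ω c hc =>
    ciSup_le fun f => hc f f.2
  refine ⟨W, Measurable.iSup fun f => h.measurable_empiricalSq (hF₀ f.2), ?_, hle,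
    ae_of_all _ hlub⟩
  filter_upwards [hle] with ω hω
  refine le_antisymm (iSup₂_le fun f hf => EReal.coe_le_coe_iff.2 (hω f hf)) ?_
  refine EReal.le_of_forall_lt_iff_le.1 fun c hlt => ?_
  refine EReal.coe_le_coe_iff.2 (hlub ω c fun f hf => ?_)
  refine EReal.coe_le_coe_iff.1 (le_trans ?_ hlt.le)
  exact le_iSup₂ (f := fun f (_ : f ∈ F) => ((empiricalSq μ X f ω : ℝ) : EReal)) f (hF₀ hf)

end Supremum

/-! ### From tail bounds to the two deviation statements -/

section Deviation

open Filter Topology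

theorem bernsteinPhi_nonneg (N : ℕ) {x : ℝ} (hx : 0 ≤ x) : 0 ≤ bernsteinPhi N x := by
  unfold bernsteinPhi
  have : 0 ≤ min (Real.sqrt N * x) (x ^ 2) := by positivity
  linarith [Real.one_le_rpow (by norm_num : (1:ℝ) ≤ 2) this]

theorem bernsteinPhi_le_of_le {N : ℕ} {x y : ℝ} (hx : 0 ≤ x) (hxy : x ≤ y) :
    bernsteinPhi N x ≤ bernsteinPhi N y := by
  unfold bernsteinPhi
  gcongr
  norm_num

theorem one_add_bernsteinPhi_div_le (N : ℕ) (x : ℝ) :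
    1 + bernsteinPhi N (x / 16) ≤ 2 ^ (min (Real.sqrt N * x) (x ^ 2) / 16) := by
  unfold bernsteinPhi
  rw [add_sub_cancel]
  refine Real.rpow_le_rpow_of_exponent_le (by norm_num) ?_
  rw [← min_div_div_right (by norm_num)]
  refine min_le_min (le_of_eq (by ring)) ?_
  nlinarith [sq_nonneg x]

variable {Ω : Type u} [MeasurableSpace Ω] {μ : Measure Ω} [IsProbabilityMeasure μ]

/-- The divisor 16 makes 2^(4^(k+1)/16) at most e^{4^k/4}, which the tail e^{-4^k} beats. The levels
R ≤ 1 contribute at most 4/3 and the series at most 2/3. -/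
theorem lintegral_two_rpow_le {R : Ω → ℝ} (hR : Measurable R)
    (h : ∀ k : ℕ, μ {ω | 4 ^ k < R ω} ≤ ENNReal.ofReal (Real.exp (-4 ^ k))) :
    ∫⁻ ω, ENNReal.ofReal ((2:ℝ) ^ (R ω / 16)) ∂μ ≤ 2 := by
  refine (lintegral_le_of_measure_gt_le hR h (H := fun x => ENNReal.ofReal ((2:ℝ) ^ (x / 16)))
    fun x y hxy => ENNReal.ofReal_le_ofReal (Real.rpow_le_rpow_of_exponent_le (by norm_num)
      (by linarith))).trans ?_
  have h2e : (2:ℝ) ≤ Real.exp 1 := by have := Real.add_one_le_exp 1; linarith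
  have h1 : (2:ℝ) ^ ((1:ℝ) / 16) ≤ 4 / 3 := by
    calc (2:ℝ) ^ ((1:ℝ) / 16) ≤ ((4 / 3 : ℝ) ^ (16:ℝ)) ^ ((1:ℝ) / 16) := by gcongr; norm_num
      _ = 4 / 3 := by rw [← Real.rpow_mul (by norm_num)]; norm_num
  have h2 : ∑' k : ℕ, ENNReal.ofReal ((2:ℝ) ^ ((4:ℝ) ^ (k + 1) / 16)) *
      ENNReal.ofReal (Real.exp (-4 ^ k)) ≤ ENNReal.ofReal (2 / 3) := by
    have hs : HasSum (fun k : ℕ => (1 / 2 : ℝ) * (1 / 4) ^ k) (2 / 3) := by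
      have := (hasSum_geometric_of_lt_one (r := (1 / 4 : ℝ)) (by norm_num)
        (by norm_num)).mul_left (1 / 2)
      norm_num at this ⊢
      exact this
    rw [← hs.tsum_eq, ENNReal.ofReal_tsum_of_nonneg (fun n => by positivity) hs.summable]
    refine ENNReal.tsum_le_tsum fun k => ?_
    rw [← ENNReal.ofReal_mul (by positivity)]
    refine ENNReal.ofReal_le_ofReal ?_
    have h4 : 1 + (k : ℝ) * 3 ≤ 4 ^ k := by
      have := one_add_mul_le_pow (by norm_num : (-2 : ℝ) ≤ 3) k
      norm_num at this
      exact this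
    have e1 : (2:ℝ) ^ ((4:ℝ) ^ (k + 1) / 16) ≤ Real.exp (4 ^ k / 4) := by
      calc (2:ℝ) ^ ((4:ℝ) ^ (k + 1) / 16) ≤ Real.exp 1 ^ ((4:ℝ) ^ (k + 1) / 16) := by gcongr
        _ = _ := by rw [← Real.exp_mul]; ring_nf
    have e2 : Real.exp (-(3 / 4)) ≤ 1 / 2 := by
      rw [Real.exp_neg, one_div]
      gcongr
      have := Real.quadratic_le_exp_of_nonneg (by norm_num : (0:ℝ) ≤ 3 / 4)
      linarith
    have e3 : Real.exp (-(9 / 4)) ≤ 1 / 4 := by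
      rw [Real.exp_neg, one_div]
      gcongr
      have := Real.quadratic_le_exp_of_nonneg (by norm_num : (0:ℝ) ≤ 9 / 4)
      linarith
    calc _ ≤ Real.exp (4 ^ k / 4) * Real.exp (-4 ^ k) := by gcongr
      _ ≤ Real.exp (-(3 / 4)) * Real.exp (-(9 / 4)) ^ k := by
        rw [← Real.exp_add, ← Real.exp_nat_mul, ← Real.exp_add, Real.exp_le_exp]
        linarith
      _ ≤ _ := by gcongr
  refine (add_le_add (ENNReal.ofReal_le_ofReal h1) h2).trans_eq ?_
  rw [← ENNReal.ofReal_add (by norm_num) (by norm_num)]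
  norm_num

/-- From tail bounds to the representation of the deviation through `bernsteinPhiInv`. -/
theorem exists_bernsteinPhiInv_bound {N : ℕ} (hN : 1 ≤ N) {W : Ω → ℝ} (hW : Measurable W)
    {a b : ℝ} (hb : 0 ≤ b)
    (h : ∀ k : ℕ, μ {ω | a + b * (2 ^ k + 4 ^ k / Real.sqrt N) < W ω} ≤
      ENNReal.ofReal (Real.exp (-4 ^ k))) :
    ∃ Z : Ω → ℝ, Measurable Z ∧ (∀ ω, 0 ≤ Z ω) ∧ Integrable Z μ ∧ ∫ ω, Z ω ∂μ ≤ 1 ∧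
      ∀ᵐ ω ∂μ, W ω ≤ a + 32 * b * bernsteinPhiInv N (Z ω) := by
  have hs : 0 < Real.sqrt N := Real.sqrt_pos.2 (by exact_mod_cast hN)
  -- With the factor 2, min(√N x, x²) > 4^k means that x exceeds both 4^k/√N and 2^k, hence W - a =
  -- 2bx exceeds b times their sum. The further rescaling by 16 in Z gives the final factor 32.
  set x : Ω → ℝ := fun ω => max (W ω - a) 0 / (2 * b) with hx
  have hxm : Measurable x := ((hW.sub_const a).max measurable_const).div_const _
  have hx0 : ∀ ω, 0 ≤ x ω := fun ω => by positivity
  set R : Ω → ℝ := fun ω => min (Real.sqrt N * x ω) (x ω ^ 2) with hR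
  have hRm : Measurable R := (hxm.const_mul _).min (hxm.pow_const 2)
  have hRt : ∀ k : ℕ, μ {ω | 4 ^ k < R ω} ≤ ENNReal.ofReal (Real.exp (-4 ^ k)) := fun k => by
    refine (measure_mono fun ω hω => ?_).trans (h k)
    simp only [Set.mem_ofPred_eq, hR, lt_min_iff] at hω ⊢
    have h4 : (0:ℝ) < 4 ^ k := by positivity
    have hxp : 0 < x ω := by
      refine (hx0 ω).lt_of_ne fun h0 => ?_
      rw [← h0] at hω
      norm_num at hω
      linarith
    have hbp : 0 < b := by
      refine hb.lt_of_ne fun h0 => ?_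
      simp [hx, ← h0] at hxp
    have h5 : 4 ^ k / Real.sqrt N < x ω := by rw [div_lt_iff₀' hs]; exact hω.1
    have h6 : (2:ℝ) ^ k < x ω := by
      refine lt_of_pow_lt_pow_left₀ 2 (hx0 ω) ?_
      rw [← pow_mul, mul_comm, pow_mul]
      norm_num
      exact hω.2
    have h7 : max (W ω - a) 0 = 2 * b * x ω := by
      simp only [hx]; field_simp
    have h8 : W ω - a = 2 * b * x ω := by
      rcases max_choice (W ω - a) 0 with h9 | h9
      · rw [← h9, h7]
      · rw [h9] at h7
        have : 0 < 2 * b * x ω := by positivity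
        linarith
    nlinarith
  set Z : Ω → ℝ := fun ω => bernsteinPhi N (x ω / 16) with hZ
  have hZm : Measurable Z := by
    simp only [hZ, bernsteinPhi]
    fun_prop
  have hZ0 : ∀ ω, 0 ≤ Z ω := fun ω => bernsteinPhi_nonneg N (by have := hx0 ω; positivity)
  have hlin : ∫⁻ ω, ENNReal.ofReal (1 + Z ω) ∂μ ≤ 2 :=
    (lintegral_mono fun ω => ENNReal.ofReal_le_ofReal
      (one_add_bernsteinPhi_div_le N (x ω))).trans (lintegral_two_rpow_le hRm hRt)
  have h1Z : ∀ ω, 0 ≤ 1 + Z ω := fun ω => by linarith [hZ0 ω]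
  have hi1 : Integrable (fun ω => 1 + Z ω) μ :=
    (lintegral_ofReal_ne_top_iff_integrable (hZm.const_add 1).aestronglyMeasurable
      (ae_of_all _ h1Z)).1 (ne_top_of_le_ne_top (by simp) hlin)
  have hi : Integrable Z μ := (hi1.sub (integrable_const 1)).congr
    (ae_of_all _ fun ω => by simp)
  refine ⟨Z, hZm, hZ0, hi, ?_, ?_⟩
  · have h2 : ∫ ω, (1 + Z ω) ∂μ ≤ 2 := by
      rw [← ENNReal.ofReal_le_ofReal_iff (by norm_num), ofReal_integral_eq_lintegral_ofReal hi1
        (ae_of_all _ h1Z)]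
      simpa using hlin
    rw [integral_add (integrable_const _) hi] at h2
    simp at h2
    linarith
  · have hinv : ∀ ω, bernsteinPhiInv N (Z ω) = x ω / 16 := fun ω =>
      bernsteinPhiInv_bernsteinPhi N hN _ (by have := hx0 ω; positivity)
    simp only [hinv]
    -- For b = 0 division by zero makes x vanish identically; then W ≤ a almost surely follows by
    -- letting k tend to infinity in the tail bounds.
    rcases hb.eq_or_lt with h0 | hbp
    · have hnull : μ {ω | a < W ω} = 0 := by
        refine le_antisymm (ge_of_tendsto' (x := atTop)
          (f := fun k : ℕ => ENNReal.ofReal (Real.exp (-4 ^ k))) ?_ fun k => ?_) zero_le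
        · rw [← ENNReal.ofReal_zero]
          refine ENNReal.tendsto_ofReal (Real.tendsto_exp_neg_atTop_nhds_zero.comp
            (tendsto_pow_atTop_atTop_of_one_lt (by norm_num)))
        · simpa [← h0] using h k
      have : ∀ᵐ ω ∂μ, ¬ a < W ω := measure_eq_zero_iff_ae_notMem.1 hnull
      filter_upwards [this] with ω hω
      rw [← h0]
      simpa using hω
    · refine ae_of_all _ fun ω => ?_
      have h7 : max (W ω - a) 0 = 2 * b * x ω := by
        simp only [hx]; field_simp
      have := le_max_left (W ω - a) 0
      linarith

/-- Markov's inequality for 1 + Z, whose mean is at most 2. With M = min(√N u, u²) ≥ 1, the factor 4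
gives 2^{4M} = 2^M 8^M ≥ 2e^M, which removes the prefactor 2. This is where u ≥ 1 is needed. -/
theorem measure_bernsteinPhiInv_gt_le {N : ℕ} (hN : 1 ≤ N) {Z : Ω → ℝ} (hZ0 : ∀ ω, 0 ≤ Z ω)
    (hZ : Integrable Z μ) (hZ1 : ∫ ω, Z ω ∂μ ≤ 1) {u : ℝ} (hu : 1 ≤ u) :
    μ {ω | 4 * u < bernsteinPhiInv N (Z ω)} ≤
      ENNReal.ofReal (Real.exp (-(min (Real.sqrt N * u) (u ^ 2)))) := by
  have hs : 1 ≤ Real.sqrt N := Real.one_le_sqrt.2 (by exact_mod_cast hN)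
  set M := min (Real.sqrt N * u) (u ^ 2) with hM
  have hM1 : 1 ≤ M := le_min (by nlinarith) (by nlinarith)
  have h4M : 4 * M ≤ min (Real.sqrt N * (4 * u)) ((4 * u) ^ 2) := by
    refine le_min ?_ ?_
    · have := min_le_left (Real.sqrt N * u) (u ^ 2); linarith
    · have := min_le_right (Real.sqrt N * u) (u ^ 2); nlinarith
  have hsub : {ω | 4 * u < bernsteinPhiInv N (Z ω)} ⊆ {ω | (2:ℝ) ^ (4 * M) ≤ 1 + Z ω} := fun ω hω => by
    simp only [Set.mem_ofPred_eq] at hω ⊢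
    have h1 := bernsteinPhi_le_of_le (N := N) (by linarith) hω.le
    rw [bernsteinPhi_bernsteinPhiInv N hN _ (hZ0 ω)] at h1
    have h2 : (2:ℝ) ^ (4 * M) ≤ 1 + bernsteinPhi N (4 * u) := by
      unfold bernsteinPhi
      rw [add_sub_cancel]
      exact Real.rpow_le_rpow_of_exponent_le (by norm_num) h4M
    linarith
  have h1 := mul_meas_ge_le_integral_of_nonneg (μ := μ) (f := fun ω => 1 + Z ω)
    (ae_of_all μ fun ω => by have := hZ0 ω; show 0 ≤ 1 + Z ω; linarith)
    ((integrable_const 1).add hZ) ((2:ℝ) ^ (4 * M))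
  rw [integral_add (integrable_const _) hZ] at h1
  simp at h1
  rw [ENNReal.le_ofReal_iff_toReal_le (measure_ne_top _ _) (Real.exp_pos _).le]
  refine (measureReal_mono hsub).trans ?_
  have h3 : 2 * Real.exp M ≤ (2:ℝ) ^ (4 * M) := by
    have h4 : Real.exp 1 ≤ (2:ℝ) ^ (3:ℝ) := by
      have := Real.exp_one_lt_d9
      norm_num
      linarith
    calc 2 * Real.exp M ≤ (2:ℝ) ^ M * ((2:ℝ) ^ (3:ℝ)) ^ M := by
          gcongr
          · exact Real.self_le_rpow_of_one_le (by norm_num) hM1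
          · rw [← Real.exp_one_rpow]; gcongr
      _ = _ := by
        rw [← Real.rpow_mul (by norm_num), ← Real.rpow_add (by norm_num)]; ring_nf
  have hpos : (0:ℝ) < 2 ^ (4 * M) := by positivity
  have h5 : μ.real {ω | (2:ℝ) ^ (4 * M) ≤ 1 + Z ω} * (2 * Real.exp M) ≤ 2 := by
    calc _ ≤ μ.real {ω | (2:ℝ) ^ (4 * M) ≤ 1 + Z ω} * (2:ℝ) ^ (4 * M) := by gcongr
      _ ≤ _ := by linarith
  rw [Real.exp_neg, ← one_div, le_div_iff₀ (Real.exp_pos _)]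
  linarith

/-- Deviations at scales below `1`, by a second moment argument. -/
theorem measure_gt_le_of_root {W Y : Ω → ℝ} (hW : Measurable W) (hY : Measurable Y) (hYW : Y ≤ᵐ[μ] W)
    {m s u : ℝ} (hm : 0 < m) (hs : 0 < s) (hY2 : MemLp Y 2 μ) (hY0 : ∫ ω, Y ω ∂μ = 0)
    (hYs : ∫ ω, Y ω ^ 2 ∂μ ≤ 36 * s ^ 2)
    (h : ∀ k : ℕ, μ {ω | m * 4 ^ k < W ω - Y ω} ≤ ENNReal.ofReal (Real.exp (-4 ^ k)))
    (hu0 : 0 < u) (hu : u ≤ 1) :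
    μ {ω | 60 * m + 48 * s * u < W ω} ≤ ENNReal.ofReal (Real.exp (-u ^ 2)) := by
  set D : Ω → ℝ := fun ω => W ω - Y ω with hD
  have hD0 : 0 ≤ᵐ[μ] D := by
    filter_upwards [hYW] with ω hω
    exact sub_nonneg.2 hω
  obtain ⟨hD2, hDsq, hDm⟩ :
      MemLp D 2 μ ∧ ∫ ω, D ω ^ 2 ∂μ ≤ 129 * m ^ 2 ∧ ∫ ω, D ω ∂μ ≤ 12 * m :=
    integral_sq_le_of_measure_gt_le (hW.sub hY) hD0 hm h
  have hDi : Integrable D μ := hD2.integrable one_le_two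
  have hYi : Integrable Y μ := hY2.integrable one_le_two
  have hDm0 : 0 ≤ ∫ ω, D ω ∂μ := integral_nonneg_of_ae hD0
  -- Subtracting 12m, which dominates the mean of D, makes the mean nonpositive. The second moment
  -- is at most 72s² + 546m².
  have hsq : ∫ ω, (Y ω + (D ω - 12 * m)) ^ 2 ∂μ ≤ (24 * (s + m)) ^ 2 := by
    have hi1 : Integrable (fun ω => 2 * Y ω ^ 2) μ := hY2.integrable_sq.const_mul 2
    have hi2 : Integrable (fun ω => 2 * D ω ^ 2) μ := hD2.integrable_sq.const_mul 2
    have hi3 : Integrable (fun ω => 288 * m ^ 2 - 48 * m * D ω) μ :=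
      (integrable_const _).sub (hDi.const_mul _)
    calc _ ≤ ∫ ω, (2 * Y ω ^ 2 + (2 * D ω ^ 2 + (288 * m ^ 2 - 48 * m * D ω))) ∂μ := by
          refine integral_mono (hY2.add (hD2.sub (memLp_const (12 * m)))).integrable_sq
            (hi1.add (hi2.add hi3)) fun ω => ?_
          simp only
          nlinarith [sq_nonneg (Y ω - (D ω - 12 * m))]
      _ ≤ _ := by
          have hi23 : Integrable (fun ω => 2 * D ω ^ 2 + (288 * m ^ 2 - 48 * m * D ω)) μ :=
            hi2.add hi3
          rw [integral_add hi1 hi23, integral_add hi2 hi3,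
            integral_sub (integrable_const _) (hDi.const_mul _), integral_const_mul,
            integral_const_mul, integral_const_mul (48 * m)]
          simp
          have : 0 ≤ m * ∫ ω, D ω ∂μ := by positivity
          have : 0 < m * s := by positivity
          nlinarith
  have hmean : ∫ ω, (Y ω + (D ω - 12 * m)) ∂μ ≤ 0 := by
    have hDi' : Integrable (fun ω => D ω - 12 * m) μ := hDi.sub (integrable_const _)
    rw [integral_add hYi hDi', integral_sub hDi (integrable_const _), hY0]
    simp
    linarith
  refine (measure_mono fun ω hω => ?_).trans (measure_ge_le_exp_neg_sq
    (hY2.add (hD2.sub (memLp_const (12 * m)))) hmean (by positivity) hsq hu0 hu)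
  have e : Y ω + (D ω - 12 * m) = W ω - 12 * m := by simp only [hD]; ring
  show 2 * u * (24 * (s + m)) ≤ Y ω + (D ω - 12 * m)
  rw [e]
  simp only [Set.mem_ofPred_eq] at hω
  -- Since u ≤ 1, 12m + 48u(s + m) ≤ 60m + 48su.
  nlinarith

end Deviation

/-! ### Limits in the parameters and assembly -/

section Main

open Filter Topology

variable {Ω : Type u} [MeasurableSpace Ω] {μ : Measure Ω}

/-- Chaining needs positive scales and a net with sum at most γ, while α and γ₂ may vanish and the
infimum in γ₂ need not be attained. Bounds for all larger parameters pass to the limit by continuity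
of the threshold. -/
theorem measure_gt_le_of_forall_perturb {W : Ω → ℝ} {p : ℝ≥0∞} {c : ℝ → ℝ → ℝ} {α γ : ℝ}
    (hc : Continuous fun x : ℝ => c (α + x) (γ + x))
    (h : ∀ α' > α, ∀ γ' > γ, μ {ω | c α' γ' < W ω} ≤ p) : μ {ω | c α γ < W ω} ≤ p := by
  refine measure_gt_le_of_forall_gt fun c' hc' => ?_
  have h0 := hc.tendsto 0
  simp only [add_zero] at h0
  have h1 : ∀ᶠ x in 𝓝[>] (0:ℝ), c (α + x) (γ + x) < c' :=
    (h0.mono_left nhdsWithin_le_nhds).eventually (gt_mem_nhds hc')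
  obtain ⟨x, hx, hx0⟩ := (h1.and self_mem_nhdsWithin).exists
  exact (measure_mono fun ω hω => hx.trans hω).trans (h _ (by linarith) _ (by linarith))

variable [IsProbabilityMeasure μ]
  {𝒳 : Type v} [MeasurableSpace 𝒳] {N : ℕ} {X : Fin N → Ω → 𝒳} {F F₀ : Set (𝒳 → ℝ)}
  {d : (𝒳 → ℝ) → (𝒳 → ℝ) → ℝ} {α γ : ℝ}

theorem exists_isAdmissible_of_gammaTwo_lt {E : Type v} {d : E → E → ℝ} {F : Set E} {γ : ℝ≥0∞}
    (h : gammaTwo d F < γ) :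
    ∃ T, IsAdmissible d F T ∧ ∀ f ∈ F, ∑' n : ℕ, 2 ^ n * distTo d f (T n) ≤ γ := by
  simp only [gammaTwo, iInf_lt_iff] at h
  obtain ⟨T, hT, hlt⟩ := h
  exact ⟨T, hT, fun f hf =>
    (le_iSup₂ (f := fun f (_ : f ∈ F) => ∑' n : ℕ, 2 ^ n * distTo d f (T n)) f hf).trans hlt.le⟩

/-- Small deviations of the supremum, for parameters that strictly dominate `α` and `γ₂`. -/
theorem IsSubgaussianFamily.measure_sup_gt_le_of_le_one (h : IsSubgaussianFamily μ X F d)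
    {T : ℕ → Finset (𝒳 → ℝ)}
    (hT : IsAdmissible d F T) (hγ : 0 < γ) (hα : 0 < α) (hFα : ∀ f ∈ F, d f 0 ≤ α)
    (hTγ : ∀ f ∈ F, ∑' n : ℕ, 2 ^ n * distTo d f (T n) ≤ ENNReal.ofReal γ)
    (hF₀ : F₀ ⊆ F) (hc : F₀.Countable) {W : Ω → ℝ} (hW : Measurable W)
    (hle : ∀ᵐ ω ∂μ, ∀ f ∈ F, empiricalSq μ X f ω ≤ W ω)
    (hlub : ∀ᵐ ω ∂μ, ∀ c, (∀ f ∈ F₀, empiricalSq μ X f ω ≤ c) → W ω ≤ c)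
    {u : ℝ} (hu0 : 0 < u) (hu : u ≤ 1) :
    μ {ω | 1320000 * (γ ^ 2 / N + α * γ / Real.sqrt N) +
      48 * (α ^ 2 / Real.sqrt N) * u < W ω} ≤ ENNReal.ofReal (Real.exp (-u ^ 2)) := by
  have hN : (0:ℝ) < N := by exact_mod_cast h.one_le
  have hs : 0 < Real.sqrt N := Real.sqrt_pos.2 hN
  have hss : Real.sqrt N ^ 2 = N := Real.sq_sqrt hN.le
  obtain ⟨g, hg, hgk⟩ := h.exists_measure_sub_gt_le hT hγ hα hFα hTγ hF₀ hc
  have hi := h.integral_mul_empiricalSq hg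
  have hsq := h.integral_mul_empiricalSq_sq_le hg (hFα g hg) hα
  have e : ∀ ω, (N * empiricalSq μ X g ω) ^ 2 = N ^ 2 * empiricalSq μ X g ω ^ 2 := fun ω =>
    mul_pow _ _ _
  simp only [e] at hsq
  rw [integral_const_mul] at hsq
  rw [integral_const_mul] at hi
  have hm := h.measurable_empiricalSq hg
  have hL : MemLp (empiricalSq μ X g) 2 μ :=
    (memLp_two_iff_integrable_sq hm.aestronglyMeasurable).2
      ((integrable_const_mul_iff (IsUnit.mk0 _ (by positivity)) _).1 hsq.1)
  have := measure_gt_le_of_root hW hm (hle.mono fun ω hω => hω g hg)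
    (m := 22000 * (γ ^ 2 / N + α * γ / Real.sqrt N)) (s := α ^ 2 / Real.sqrt N) (by positivity)
    (by positivity) hL ((mul_eq_zero.1 hi.2).resolve_left hN.ne') ?_ (fun k => ?_) hu0 hu
  · convert this using 5
    ring
  · refine le_of_mul_le_mul_left (hsq.2.trans_eq ?_) (by positivity : (0:ℝ) < N ^ 2)
    rw [div_pow, hss]
    field_simp
  · refine (measure_mono_ae ?_).trans (hgk k)
    filter_upwards [hlub] with ω hω hlt hcon
    have h1 := hω _ hcon
    have h2 : 22000 * (γ ^ 2 / N + α * γ / Real.sqrt N) * 4 ^ k < W ω - empiricalSq μ X g ω := hlt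
    linarith

end Main

theorem theorem1 :
    ∃ A B A' B' : ℝ, 0 < A ∧ 0 < B ∧ 0 < A' ∧ 0 < B' ∧
      ∀ (Ω : Type u) (𝒳 : Type v) [MeasurableSpace Ω] [MeasurableSpace 𝒳]
        (μ : Measure Ω) [IsProbabilityMeasure μ]
        (N : ℕ) (_ : 1 ≤ N)
        (X : Fin N → Ω → 𝒳) (_ : ∀ i, Measurable (X i)) (_ : iIndepFun X μ)
        (F : Set (𝒳 → ℝ)) (_ : ∀ f ∈ F, Measurable f)
        (d : (𝒳 → ℝ) → (𝒳 → ℝ) → ℝ) (_ : IsDistOn d (insert 0 F))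
        (_ : ∀ f ∈ F, ∀ g ∈ F, ∀ i, ∀ u : ℝ, 0 < u →
          μ.real {ω | u ≤ |f (X i ω) - g (X i ω)|} ≤ subgaussianTail u (d f g))
        (_ : ∀ f ∈ F, ∀ i, ∀ u : ℝ, 0 < u →
          μ.real {ω | u ≤ |f (X i ω)|} ≤ subgaussianTail u (d f 0))
        (_ : IsSeparableProcess μ d F (empiricalSq μ X))
        (α : ℝ) (_ : IsLUB ((fun f => d f 0) '' F) α)
        (γ : ℝ) (_ : gammaTwo d F = ENNReal.ofReal γ) (_ : 0 ≤ γ),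
        (∃ Z : Ω → ℝ, Measurable Z ∧ (∀ ω, 0 ≤ Z ω) ∧ Integrable Z μ ∧ ∫ ω, Z ω ∂μ ≤ 1 ∧
          ∀ᵐ ω ∂μ, supEmpiricalSq μ X F ω ≤
            ((A * (γ ^ 2 / N + α * γ / Real.sqrt N)
              + B * (α ^ 2 / Real.sqrt N) * bernsteinPhiInv N (Z ω) : ℝ) : EReal)) ∧
        (∀ u : ℝ, 0 ≤ u →
          μ.real {ω | ((A' * (γ ^ 2 / N + α * γ / Real.sqrt N)
              + B' * (α ^ 2 / Real.sqrt N) * u : ℝ) : EReal) < supEmpiricalSq μ X F ω}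
            ≤ Real.exp (-(min (Real.sqrt N * u) (u ^ 2)))) := by
  -- Here 544000 = 32·17000 from the construction of Z, 1320000 = 60·22000 from the small-deviation
  -- bound, and 2176000 = 4·544000 from Markov's inequality.
  refine ⟨17000, 544000, 1320000, 2176000, by norm_num, by norm_num, by norm_num, by norm_num, ?_⟩
  intro Ω 𝒳 _ _ μ _ N hN X hX hind F hF d hd hinc htail ⟨F₀, hF₀, hc, hsep⟩ α hα γ hγ hγ0
  have h : IsSubgaussianFamily μ X F d := ⟨hN, hX, hind, hF, hd, hinc, htail⟩
  have hne : F.Nonempty := by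
    rw [Set.nonempty_iff_ne_empty]
    rintro rfl
    rw [Set.image_empty, isLUB_empty_iff] at hα
    linarith [hα (α - 1)]
  have hFα : ∀ f ∈ F, d f 0 ≤ α := fun f hf => hα.1 ⟨f, hf, rfl⟩
  have hα0 : 0 ≤ α := by
    obtain ⟨f, hf⟩ := hne
    exact (hd.nonneg f (.inr hf) 0 (.inl rfl)).trans (hFα f hf)
  have hs : 1 ≤ Real.sqrt N := Real.one_le_sqrt.2 (by exact_mod_cast hN)
  have hnet : ∀ γ' > γ, ∃ T, IsAdmissible d F T ∧
      ∀ f ∈ F, ∑' n : ℕ, 2 ^ n * distTo d f (T n) ≤ ENNReal.ofReal γ' := fun γ' hγ' =>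
    exists_isAdmissible_of_gammaTwo_lt
      (by rw [hγ]; exact (ENNReal.ofReal_lt_ofReal_iff (by linarith)).2 hγ')
  have htails : ∀ k : ℕ, ∀ α' > α, ∀ γ' > γ, μ {ω | ¬ ∀ f ∈ F₀, empiricalSq μ X f ω ≤
      17000 * (γ' ^ 2 / N + α' * γ' / Real.sqrt N) +
      17000 * (α' ^ 2 / Real.sqrt N) * (2 ^ k + 4 ^ k / Real.sqrt N)} ≤
      ENNReal.ofReal (Real.exp (-4 ^ k)) := fun k α' hα' γ' hγ' => by
    obtain ⟨T, hT, hTγ⟩ := hnet γ' hγ'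
    exact h.measure_exists_gt_le hT (by linarith) (by linarith)
      (fun f hf => (hFα f hf).trans hα'.le) hTγ hF₀ hc k
  -- Unboundedness lies in the failure event of every level k, and the probabilities of these events
  -- tend to 0.
  have hbdd : ∀ᵐ ω ∂μ, ∃ c, ∀ f ∈ F₀, empiricalSq μ X f ω ≤ c := by
    refine le_antisymm (ge_of_tendsto' (x := Filter.atTop)
      (f := fun k : ℕ => ENNReal.ofReal (Real.exp (-4 ^ k))) ?_ fun k => ?_) zero_le
    · rw [← ENNReal.ofReal_zero]
      exact ENNReal.tendsto_ofReal (Real.tendsto_exp_neg_atTop_nhds_zero.comp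
        (tendsto_pow_atTop_atTop_of_one_lt (by norm_num)))
    · refine (measure_mono fun ω hω => ?_).trans
        (htails k (α + 1) (by linarith) (γ + 1) (by linarith))
      exact fun hcon => hω ⟨_, hcon⟩
  obtain ⟨W, hW, hsup, hle, hlub⟩ := h.exists_measurable_sup hne hF₀ hc hsep hbdd
  have htailW : ∀ k : ℕ, μ {ω | 17000 * (γ ^ 2 / N + α * γ / Real.sqrt N) +
      17000 * (α ^ 2 / Real.sqrt N) * (2 ^ k + 4 ^ k / Real.sqrt N) < W ω} ≤
      ENNReal.ofReal (Real.exp (-4 ^ k)) := fun k => by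
    refine measure_gt_le_of_forall_perturb (c := fun α γ => 17000 * (γ ^ 2 / N +
      α * γ / Real.sqrt N) + 17000 * (α ^ 2 / Real.sqrt N) * (2 ^ k + 4 ^ k / Real.sqrt N))
      (by fun_prop) fun α' hα' γ' hγ' => ?_
    refine (measure_mono_ae ?_).trans (htails k α' hα' γ' hγ')
    filter_upwards [hlub] with ω hω hlt hcon
    exact absurd (hω _ hcon) (not_le.2 hlt)
  obtain ⟨Z, hZ, hZ0, hZi, hZ1, hZW⟩ := exists_bernsteinPhiInv_bound hN hW
    (b := 17000 * (α ^ 2 / Real.sqrt N)) (by positivity) htailW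
  refine ⟨⟨Z, hZ, hZ0, hZi, hZ1, ?_⟩, fun u hu0 => ?_⟩
  · filter_upwards [hsup, hZW] with ω h1 h2
    rw [h1, EReal.coe_le_coe_iff]
    refine h2.trans_eq ?_
    ring
  · have hcongr : μ {ω | ((1320000 * (γ ^ 2 / N + α * γ / Real.sqrt N)
        + 2176000 * (α ^ 2 / Real.sqrt N) * u : ℝ) : EReal) < supEmpiricalSq μ X F ω} ≤
        μ {ω | 1320000 * (γ ^ 2 / N + α * γ / Real.sqrt N)
          + 2176000 * (α ^ 2 / Real.sqrt N) * u < W ω} := by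
      refine measure_mono_ae ?_
      filter_upwards [hsup] with ω h1 h2
      have h3 : _ < supEmpiricalSq μ X F ω := h2
      rw [h1, EReal.coe_lt_coe_iff] at h3
      exact h3
    refine ENNReal.toReal_le_of_le_ofReal (Real.exp_pos _).le (hcongr.trans ?_)
    have hm0 : 0 ≤ γ ^ 2 / N + α * γ / Real.sqrt N := by positivity
    have hs0 : 0 ≤ α ^ 2 / Real.sqrt N := by positivity
    -- For u ≥ 1 the tail of Z suffices; for 0 < u ≤ 1 the minimum is u², since √N ≥ 1, and the
    -- second-moment bound applies.
    rcases le_total 1 u with hu | hu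
    · refine (measure_mono_ae ?_).trans (measure_bernsteinPhiInv_gt_le hN hZ0 hZi hZ1 hu)
      filter_upwards [hZW] with ω h1 h2
      have h3 : 1320000 * (γ ^ 2 / N + α * γ / Real.sqrt N)
          + 2176000 * (α ^ 2 / Real.sqrt N) * u < W ω := h2
      show 4 * u < bernsteinPhiInv N (Z ω)
      by_contra! hcon
      nlinarith
    · rcases hu0.eq_or_lt with rfl | hupos
      · simpa using prob_le_one
      · have hmin : min (Real.sqrt N * u) (u ^ 2) = u ^ 2 := min_eq_right (by nlinarith)
        rw [hmin]
        refine (measure_mono fun ω hω => ?_).trans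
          (measure_gt_le_of_forall_perturb (W := W) (α := α) (γ := γ) (c := fun α γ =>
            1320000 * (γ ^ 2 / N + α * γ / Real.sqrt N) + 48 * (α ^ 2 / Real.sqrt N) * u)
            (by fun_prop) fun α' hα' γ' hγ' => ?_)
        · simp only [Set.mem_ofPred_eq] at hω ⊢
          have : 0 ≤ α ^ 2 / Real.sqrt N * u := by positivity
          linarith
        · obtain ⟨T, hT, hTγ⟩ := hnet γ' hγ'
          exact h.measure_sup_gt_le_of_le_one hT (by linarith) (by linarith)
            (fun f hf => (hFα f hf).trans hα'.le) hTγ hF₀ hc hW hle hlub hupos hu
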